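/- Let $a>b>0$ and $c=\sqrt{a^2-b^2}$. Let $E=\{x^2/a^2+y^2/b^2<1\}$ and $\Omega=\{x^2/a^2+y^2/b^2>1\}$ be the interior and the exterior of the ellipse in $\mathbb C$ ($z=x+iy$), let $\mathbb D=\{|\zeta|<1\}$, $\mathbb D^e=\{1<|\zeta|<\infty\}$, and let $f(\zeta)=\tfrac12\big((a-b)\zeta+(a+b)\zeta^{-1}\big)$ be the Joukowski map. (1) $f$ maps $\mathbb D\setminus\{0\}$ bijectively onto $\Omega$ and has a simple pole at $0$. On $\mathbb D^e$, counting multiplicities, $f$ takes every value of $E$ exactly twice and every value of $\mathbb C\setminus E$ exactly once, and it has a simple pole at $\infty$. (Thus $f(\mathbb D)$ is the exterior of the ellipse in the Riemann sphere, and $f(\mathbb D^e\cup\{\infty\})$ is a complementary domain that is two-sheeted over $E$ and one-sheeted over the rest of the sphere.) (2) Put $$\zeta_{\rm int}=\frac ic\sqrt{2+a^2+b^2-2\sqrt{(1+a^2)(1+b^2)}},\qquad \zeta_{\rm ext}=\frac ic\sqrt{2+a^2+b^2+2\sqrt{(1+a^2)(1+b^2)}},$$ $$z_{\rm int}=\frac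 ic\sqrt{2a^2b^2+a^2+b^2+2ab\sqrt{(1+a^2)(1+b^2)}},\qquad z_{\rm ext}=\frac ic\sqrt{2a^2b^2+a^2+b^2-2ab\sqrt{(1+a^2)(1+b^2)}}.$$ Then $\zeta_{\rm int}\in\mathbb D\setminus\{0\}$, $\zeta_{\rm ext}\in\mathbb D^e$, $f(\pm\zeta_{\rm int})=\mp z_{\rm int}$, $f(\pm\zeta_{\rm ext})=\pm z_{\rm ext}$, the numbers $z_{\rm int},z_{\rm ext}$ are purely imaginary with $0<\operatorname{Im}z_{\rm ext}<1<\operatorname{Im}z_{\rm int}$, and $\pm z_{\rm int}\in\Omega$. (3) Put $$A_{\rm int}=\frac12\Big(1-\frac{ab}{\sqrt{(1+a^2)(1+b^2)}}\Big),\qquad A_{\rm ext}=\frac12\Big(1+\frac{ab}{\sqrt{(1+a^2)(1+b^2)}}\Big).$$ Then $A_{\rm int}+A_{\rm ext}=1$, and the following identities hold. - For every holomorphic function $h$ on $\Omega$ that is integrable on $\Omega$ with respect to $(1+|z|^2)^{-2}\,dx\,dy$, $$\frac1{2\pi i}\int_\Omega h(z)\,\frac{d\bar z\wedge dz}{(1+|z|^2)^2}=A_{\rm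 int}\big(h(z_{\rm int})+h(-z_{\rm int})\big).$$ - For every function $h$ that is holomorphic on $\mathbb D\setminus\{0\}$ (in particular for $h$ holomorphic on $\mathbb D$) and integrable on $\mathbb D$ with respect to $|f'|^2(1+|f|^2)^{-2}\,dx\,dy$, $$\frac1{2\pi i}\int_{\mathbb D} h\,\frac{d\bar f\wedge df}{(1+|f|^2)^2}=A_{\rm int}\big(h(\zeta_{\rm int})+h(-\zeta_{\rm int})\big).$$ - For every function $h$ that is holomorphic on $\mathbb D^e$ (no condition at $\infty$) and integrable on $\mathbb D^e$ with respect to $|f'|^2(1+|f|^2)^{-2}\,dx\,dy$, $$\frac1{2\pi i}\int_{\mathbb D^e} h\,\frac{d\bar f\wedge df}{(1+|f|^2)^2}=A_{\rm ext}\big(h(\zeta_{\rm ext})+h(-\zeta_{\rm ext})\big).$$ -/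

import Mathlib

open MeasureTheory Set Complex

noncomputable section

namespace EllipseQuadrature

/-- The (finite part of the) exterior `x²/a² + y²/b² > 1` of the ellipse. -/
def ellipseExterior (a b : ℝ) : Set ℂ :=
  {z | 1 < z.re ^ 2 / a ^ 2 + z.im ^ 2 / b ^ 2}

/-- The interior `x²/a² + y²/b² < 1` of the ellipse. -/
def ellipseInterior (a b : ℝ) : Set ℂ :=
  {z | z.re ^ 2 / a ^ 2 + z.im ^ 2 / b ^ 2 < 1}

/-- The unit disk `𝔻`, in the parameter plane. -/
def unitDisk : Set ℂ := {ζ | ‖ζ‖ < 1}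

/-- The finite part of the exterior `𝔻ᵉ` of the unit disk, in the parameter plane. -/
def diskExterior : Set ℂ := {ζ | 1 < ‖ζ‖}

/-- The Joukowski map `f(ζ) = ((a - b) ζ + (a + b) ζ⁻¹) / 2`.  As a map of Riemann spheres it has
the poles `0` and `∞`; the value that Lean gives it at `ζ = 0` is never used. -/
def joukowski (a b : ℝ) (ζ : ℂ) : ℂ :=
  (((a : ℂ) - b) * ζ + ((a : ℂ) + b) * ζ⁻¹) / 2

/-- The half focal distance `c = √(a² - b²)`. -/
def focal (a b : ℝ) : ℝ := √(a ^ 2 - b ^ 2)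

/-- The coefficient with respect to `dx ∧ dy` of the form `dz̄ ∧ dz / (1 + |z|²)²`
(recall `dz̄ ∧ dz = 2i dx ∧ dy`). -/
def sphericalForm (z : ℂ) : ℂ := 2 * I / (1 + (‖z‖ : ℂ) ^ 2) ^ 2

/-- The coefficient with respect to `dx ∧ dy`, `ζ = x + iy`, of the pulled back form
`df̄ ∧ df / (1 + |f|²)²` (recall `df̄ ∧ df = |f'|² dζ̄ ∧ dζ` for holomorphic `f`). -/
def pullbackForm (f : ℂ → ℂ) (ζ : ℂ) : ℂ :=
  2 * I * (‖deriv f ζ‖ : ℂ) ^ 2 / (1 + (‖f ζ‖ : ℂ) ^ 2) ^ 2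

/-- `(1 / 2πi) ∫_U h dz̄ ∧ dz / (1 + |z|²)²`. -/
def sphericalIntegral (U : Set ℂ) (h : ℂ → ℂ) : ℂ :=
  1 / (2 * Real.pi * I) * ∫ z in U, h z * sphericalForm z

/-- `(1 / 2πi) ∫_U h df̄ ∧ df / (1 + |f|²)²`. -/
def pullbackIntegral (f : ℂ → ℂ) (U : Set ℂ) (h : ℂ → ℂ) : ℂ :=
  1 / (2 * Real.pi * I) * ∫ ζ in U, h ζ * pullbackForm f ζ

/-- The number of solutions `ζ ∈ U` of `f ζ = z`, counted with multiplicity: the number of sheets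
over `z` of the domain `f(U)`. -/
def sheetNumber (f : ℂ → ℂ) (U : Set ℂ) (z : ℂ) : ℕ :=
  ∑ᶠ ζ ∈ U, analyticOrderNatAt (fun w => f w - z) ζ

/-- The interior node in the parameter plane. -/
def zetaInt (a b : ℝ) : ℂ :=
  I / focal a b * (√(2 + a ^ 2 + b ^ 2 - 2 * √((1 + a ^ 2) * (1 + b ^ 2))) : ℝ)

/-- The exterior node in the parameter plane. -/
def zetaExt (a b : ℝ) : ℂ :=
  I / focal a b * (√(2 + a ^ 2 + b ^ 2 + 2 * √((1 + a ^ 2) * (1 + b ^ 2))) : ℝ)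

/-- The node in the physical plane of the exterior of the ellipse. -/
def zInt (a b : ℝ) : ℂ :=
  I / focal a b *
    (√(2 * a ^ 2 * b ^ 2 + a ^ 2 + b ^ 2 + 2 * a * b * √((1 + a ^ 2) * (1 + b ^ 2))) : ℝ)

/-- The node in the physical plane of the complementary two-sheeted domain. -/
def zExt (a b : ℝ) : ℂ :=
  I / focal a b *
    (√(2 * a ^ 2 * b ^ 2 + a ^ 2 + b ^ 2 - 2 * a * b * √((1 + a ^ 2) * (1 + b ^ 2))) : ℝ)

/-- The weight of the exterior of the ellipse. -/
def weightInt (a b : ℝ) : ℝ := 1 / 2 * (1 - a * b / √((1 + a ^ 2) * (1 + b ^ 2)))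

/-- The weight of the complementary two-sheeted domain. -/
def weightExt (a b : ℝ) : ℝ := 1 / 2 * (1 + a * b / √((1 + a ^ 2) * (1 + b ^ 2)))

end EllipseQuadrature

end

noncomputable section

namespace EllipseQuadrature

/-! ### Wirtinger derivatives as real linear maps -/

open Filter Topology

/-! Write f = pζ + q/ζ with p = (a-b)/2 and q = (a+b)/2. The pulled back density |f'|²/(1+|f|²)² is
the ∂/∂ζ̄-derivative of K = f' f̄/(1+|f|²) + 1/ζ; the holomorphic term 1/ζ cancels the singularity
of f'/f at the pole 0. On |ζ| = r one has ζ̄ = r²/ζ, so K coincides there with a rational function R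
(`densityPotential_eq_circlePotential`). Stokes' theorem turns the integral of h times the density
over |ζ| < r into a contour integral of hK, hence of hR. In that disk R has exactly two poles, ±iy,
with equal residues: these are the nodes and the weight (`circleIntegral_mul_circlePotential_sub`).

Two boundary terms need care, since h may be singular at 0 and is not controlled at |ζ| = 1. Near 0
a disk of radius ε is removed. On its boundary K and R are O(ε), while the density is bounded below
because f has a simple pole, so the error is at most a constant times ε² times the angular integral
of |h · density|. This is arbitrarily small for suitable small ε, since otherwise dρ/ρ would be
integrable at 0 (`frequently_sq_mul_integral_circleMap_lt`). At the outer boundary the identity is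
proved for r < 1 and r tends to 1, the nodes and the weight depending continuously on r.

The exterior of the disk follows from ζ ↦ 1/ζ, which exchanges p and q, and the exterior of the
ellipse from the change of variables z = f(ζ). The sheet counts come from the quadratic pζ² - zζ +
q, whose roots have product q/p > 1, and from a factorization of the ellipse equation at f(ζ)
(`ellipseForm_joukowski`). -/

/-- `A dz + B dz̄` as a real linear map. -/
def wirtinger (A B : ℂ) : ℂ →L[ℝ] ℂ :=
  A • (ContinuousLinearMap.id ℝ ℂ) + B • (conjCLE : ℂ →L[ℝ] ℂ)

@[simp] lemma wirtinger_apply (A B v : ℂ) :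
    wirtinger A B v = A * v + B * (starRingEnd ℂ) v := by
  simp [wirtinger]

lemma HasDerivAt.hasFDerivAt_wirtinger {f : ℂ → ℂ} {A z : ℂ} (hf : HasDerivAt f A z) :
    HasFDerivAt f (wirtinger A 0) z := by
  have h := hf.hasFDerivAt.restrictScalars ℝ
  refine h.congr_fderiv ?_
  ext; simp [mul_comm]

lemma hasFDerivAt_wirtinger_conj {f : ℂ → ℂ} {A B z : ℂ} (hf : HasFDerivAt f (wirtinger A B) z) :
    HasFDerivAt (fun z => (starRingEnd ℂ) (f z))
      (wirtinger ((starRingEnd ℂ) B) ((starRingEnd ℂ) A)) z := by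
  have h := (conjCLE : ℂ →L[ℝ] ℂ).hasFDerivAt.comp z hf
  refine h.congr_fderiv ?_
  ext; simp [add_comm]

lemma hasFDerivAt_wirtinger_mul {f g : ℂ → ℂ} {A B A' B' z : ℂ}
    (hf : HasFDerivAt f (wirtinger A B) z) (hg : HasFDerivAt g (wirtinger A' B') z) :
    HasFDerivAt (fun z => f z * g z)
      (wirtinger (f z * A' + g z * A) (f z * B' + g z * B)) z := by
  refine (hf.mul hg).congr_fderiv ?_
  ext; simp; ring

lemma hasFDerivAt_wirtinger_add {f g : ℂ → ℂ} {A B A' B' z : ℂ}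
    (hf : HasFDerivAt f (wirtinger A B) z) (hg : HasFDerivAt g (wirtinger A' B') z) :
    HasFDerivAt (fun z => f z + g z) (wirtinger (A + A') (B + B')) z := by
  refine (hf.add hg).congr_fderiv ?_
  ext; simp; ring

lemma hasFDerivAt_wirtinger_inv {f : ℂ → ℂ} {A B z : ℂ}
    (hf : HasFDerivAt f (wirtinger A B) z) (h0 : f z ≠ 0) :
    HasFDerivAt (fun z => (f z)⁻¹) (wirtinger (-A / f z ^ 2) (-B / f z ^ 2)) z := by
  have h := (HasDerivAt.hasFDerivAt_wirtinger (hasDerivAt_inv h0)).comp z hf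
  refine h.congr_fderiv ?_
  ext; simp; ring

/-! ### Stokes and Cauchy on an annulus -/

lemma hasFDerivAt_circleMap (p : ℝ × ℝ) :
    HasFDerivAt (fun p : ℝ × ℝ => circleMap 0 p.1 p.2)
      ((ContinuousLinearMap.fst ℝ ℝ ℝ).smulRight (exp (p.2 * I)) +
        (ContinuousLinearMap.snd ℝ ℝ ℝ).smulRight (I * circleMap 0 p.1 p.2)) p := by
  have h1 : HasFDerivAt (fun p : ℝ × ℝ => (p.1 : ℂ))
      (ofRealCLM.comp (ContinuousLinearMap.fst ℝ ℝ ℝ)) p :=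
    ofRealCLM.hasFDerivAt.comp p hasFDerivAt_fst
  have h2 : HasFDerivAt (fun p : ℝ × ℝ => (p.2 : ℂ) * I)
      ((ofRealCLM.comp (ContinuousLinearMap.snd ℝ ℝ ℝ)).smulRight I) p :=
    (ofRealCLM.hasFDerivAt.comp p hasFDerivAt_snd).mul_const' I
  have h3 := h1.mul h2.cexp
  simp only [circleMap, zero_add]
  refine h3.congr_fderiv ?_
  ext <;> simp
  ring

lemma polarCoord_symm_eq_circleMap (p : ℝ × ℝ) :
    Complex.polarCoord.symm p = circleMap 0 p.1 p.2 := by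
  simp [circleMap, exp_mul_I]

/-- Periodicity moves the angular range [0, 2π] to the range (-π, π) used by polar coordinates. -/
lemma circleIntegral_eq_integral_neg_pi_pi (K : ℂ → ℂ) (r : ℝ) :
    (∮ z in C(0, r), K z) =
      ∫ θ in (-Real.pi)..Real.pi, I * circleMap 0 r θ * K (circleMap 0 r θ) := by
  have hper : Function.Periodic (fun θ : ℝ => I * circleMap 0 r θ * K (circleMap 0 r θ))
      (2 * Real.pi) := fun θ => by simp only [periodic_circleMap 0 r θ]
  have h := hper.intervalIntegral_add_eq 0 (-Real.pi)
  rw [zero_add, show -Real.pi + 2 * Real.pi = Real.pi by ring] at h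
  rw [← h, circleIntegral]
  simp only [deriv_circleMap, smul_eq_mul, mul_comm I]

lemma mem_annulus_circleMap {ε r ρ θ : ℝ} (hε : 0 < ε) (h : ρ ∈ Icc ε r) :
    circleMap 0 ρ θ ∈ {z : ℂ | ε ≤ ‖z‖ ∧ ‖z‖ ≤ r} := by
  have : 0 ≤ ρ := hε.le.trans h.1
  simpa [abs_of_nonneg this] using h

/-- Integration over an annulus in polar coordinates. -/
lemma setIntegral_annulus_eq_polar (B : ℂ → ℂ) {ε r : ℝ} (hε : 0 < ε) :
    ∫ z in {z : ℂ | ε < ‖z‖ ∧ ‖z‖ < r}, B z =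
      ∫ p in Icc (ε, -Real.pi) (r, Real.pi), (p.1 : ℂ) * B (circleMap 0 p.1 p.2) := by
  have hm : MeasurableSet {z : ℂ | ε < ‖z‖ ∧ ‖z‖ < r} :=
    ((isOpen_lt continuous_const continuous_norm).inter
      (isOpen_lt continuous_norm continuous_const)).measurableSet
  have hae : (Ioo ε r ×ˢ Ioo (-Real.pi) Real.pi : Set (ℝ × ℝ)) =ᵐ[volume]
      Icc (ε, -Real.pi) (r, Real.pi) := by
    rw [Icc_prod_eq, Measure.volume_eq_prod]
    exact Measure.set_prod_ae_eq Ioo_ae_eq_Icc Ioo_ae_eq_Icc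
  rw [← integral_indicator hm, ← Complex.integral_comp_polarCoord_symm,
    ← setIntegral_congr_set hae]
  · rw [← integral_indicator (measurableSet_Ioo.prod measurableSet_Ioo), ← integral_indicator
      polarCoord.open_target.measurableSet]
    congr 1
    ext p
    simp only [indicator, polarCoord_target, polarCoord_symm_eq_circleMap, mem_prod, mem_Ioi,
      mem_Ioo, mem_ofPred_eq, norm_circleMap_zero]
    by_cases h1 : 0 < p.1
    · simp only [abs_of_pos h1, h1, true_and]
      by_cases h2 : -Real.pi < p.2 ∧ p.2 < Real.pi <;>
      by_cases h3 : ε < p.1 ∧ p.1 < r <;> simp [h2, h3]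
    · have : ¬ ε < p.1 := fun h => h1 (hε.trans h)
      simp [h1, this]

/-- **Stokes' theorem** on an annulus, for the form `K dz` with `∂K/∂z̄ = B`. -/
theorem integral_annulus_eq_circleIntegral_sub {K A B : ℂ → ℂ} {ε r : ℝ} (hε : 0 < ε)
    (hεr : ε ≤ r)
    (hK : ∀ z : ℂ, ε ≤ ‖z‖ → ‖z‖ ≤ r → HasFDerivAt K (wirtinger (A z) (B z)) z)
    (hB : ContinuousOn B {z : ℂ | ε ≤ ‖z‖ ∧ ‖z‖ ≤ r}) :
    2 * I * ∫ z in {z : ℂ | ε < ‖z‖ ∧ ‖z‖ < r}, B z =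
      (∮ z in C(0, r), K z) - ∮ z in C(0, ε), K z := by
  have hcm : Continuous (fun p : ℝ × ℝ => circleMap 0 p.1 p.2) := by
    unfold circleMap; fun_prop
  have hmaps : MapsTo (fun p : ℝ × ℝ => circleMap 0 p.1 p.2) (Icc (ε, -Real.pi) (r, Real.pi))
      {z : ℂ | ε ≤ ‖z‖ ∧ ‖z‖ ≤ r} := fun p hp =>
    mem_annulus_circleMap hε ⟨hp.1.1, hp.2.1⟩
  have hKc : ContinuousOn (fun p : ℝ × ℝ => K (circleMap 0 p.1 p.2))
      (Icc (ε, -Real.pi) (r, Real.pi)) := by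
    refine ContinuousOn.comp (t := {z : ℂ | ε ≤ ‖z‖ ∧ ‖z‖ ≤ r}) ?_ hcm.continuousOn hmaps
    exact fun z hz => (hK z hz.1 hz.2).continuousAt.continuousWithinAt
  have hBc : ContinuousOn (fun p : ℝ × ℝ => (p.1 : ℂ) * B (circleMap 0 p.1 p.2))
      (Icc (ε, -Real.pi) (r, Real.pi)) :=
    ContinuousOn.mul (by fun_prop) (hB.comp hcm.continuousOn hmaps)
  -- In polar coordinates K dz = K e^{iθ} dρ + iζK dθ. Stokes becomes the divergence theorem on a
  -- rectangle for the field (iζK, -e^{iθ}K); `f'` and `g'` are the derivatives of its components.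
  set f' : ℝ × ℝ → ℝ × ℝ →L[ℝ] ℂ := fun p =>
    (I * circleMap 0 p.1 p.2) •
      ((wirtinger (A (circleMap 0 p.1 p.2)) (B (circleMap 0 p.1 p.2))).comp
      ((ContinuousLinearMap.fst ℝ ℝ ℝ).smulRight (exp (p.2 * I)) +
        (ContinuousLinearMap.snd ℝ ℝ ℝ).smulRight (I * circleMap 0 p.1 p.2))) +
    (K (circleMap 0 p.1 p.2)) • (I • ((ContinuousLinearMap.fst ℝ ℝ ℝ).smulRight (exp (p.2 * I)) +
        (ContinuousLinearMap.snd ℝ ℝ ℝ).smulRight (I * circleMap 0 p.1 p.2))) with hf'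
  set g' : ℝ × ℝ → ℝ × ℝ →L[ℝ] ℂ := fun p =>
    (-exp (p.2 * I)) • ((wirtinger (A (circleMap 0 p.1 p.2)) (B (circleMap 0 p.1 p.2))).comp
      ((ContinuousLinearMap.fst ℝ ℝ ℝ).smulRight (exp (p.2 * I)) +
        (ContinuousLinearMap.snd ℝ ℝ ℝ).smulRight (I * circleMap 0 p.1 p.2))) +
    (K (circleMap 0 p.1 p.2)) • ((ContinuousLinearMap.snd ℝ ℝ ℝ).smulRight
      (-(exp (p.2 * I) * I))) with hg'
  -- The terms in A and in K cancel, and each component contributes iρB.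
  have hdiv : ∀ p : ℝ × ℝ, f' p (1, 0) + g' p (0, 1) =
      2 * I * ((p.1 : ℂ) * B (circleMap 0 p.1 p.2)) := by
    intro p
    have h1 : (starRingEnd ℂ) (exp (p.2 * I)) * exp (p.2 * I) = 1 := by
      rw [← exp_conj, ← Complex.exp_add]; simp
    have h2 : circleMap 0 p.1 p.2 = p.1 * exp (p.2 * I) := by simp [circleMap]
    simp only [hf', hg', add_apply, smul_apply,
      ContinuousLinearMap.comp_apply, ContinuousLinearMap.smulRight_apply,
      ContinuousLinearMap.coe_fst', ContinuousLinearMap.coe_snd', wirtinger_apply, smul_eq_mul,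
      one_smul, zero_smul, add_zero, zero_add, map_mul, conj_I]
    rw [h2] at *
    simp only [map_mul, conj_ofReal]
    linear_combination (2 * I * p.1 * B (p.1 * exp (p.2 * I))) * h1
  have hKd : ∀ p ∈ Ioo ε r ×ˢ Ioo (-Real.pi) Real.pi,
      HasFDerivAt (fun p : ℝ × ℝ => K (circleMap 0 p.1 p.2))
        ((wirtinger (A (circleMap 0 p.1 p.2)) (B (circleMap 0 p.1 p.2))).comp
      ((ContinuousLinearMap.fst ℝ ℝ ℝ).smulRight (exp (p.2 * I)) +
        (ContinuousLinearMap.snd ℝ ℝ ℝ).smulRight (I * circleMap 0 p.1 p.2))) p := by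
    intro p hp
    have hz := mem_annulus_circleMap (θ := p.2) hε (Ioo_subset_Icc_self hp.1)
    exact (hK _ hz.1 hz.2).comp p (hasFDerivAt_circleMap p)
  have hdiv2 := integral_divergence_prod_Icc_of_hasFDerivAt_of_le
    (fun p : ℝ × ℝ => I * circleMap 0 p.1 p.2 * K (circleMap 0 p.1 p.2))
    (fun p : ℝ × ℝ => -exp (p.2 * I) * K (circleMap 0 p.1 p.2)) f' g'
    (ε, -Real.pi) (r, Real.pi) ⟨hεr, by simpa using Real.pi_pos.le⟩
    ((by fun_prop : ContinuousOn (fun p : ℝ × ℝ => I * circleMap 0 p.1 p.2) _).mul hKc)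
    (ContinuousOn.mul (by fun_prop) hKc)
    (fun p hp => ((hasFDerivAt_circleMap p).const_mul I).mul (hKd p hp))
    (fun p hp => by
      have h2 : HasFDerivAt (fun p : ℝ × ℝ => -exp ((p.2 : ℂ) * I))
          ((ContinuousLinearMap.snd ℝ ℝ ℝ).smulRight (-(exp (p.2 * I) * I))) p := by
        have := (((ofRealCLM.hasFDerivAt.comp p hasFDerivAt_snd).mul_const' I).cexp).neg
        refine this.congr_fderiv ?_
        ext <;> simp
      exact h2.mul (hKd p hp))
    (by
      simp only [hdiv]
      exact (continuousOn_const.mul hBc).integrableOn_compact isCompact_Icc)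
  simp only [hdiv] at hdiv2
  rw [integral_const_mul] at hdiv2
  rw [setIntegral_annulus_eq_polar B hε, hdiv2, circleIntegral_eq_integral_neg_pi_pi,
    circleIntegral_eq_integral_neg_pi_pi]
  -- The sides θ = π and θ = -π of the rectangle cancel by periodicity.
  have h1 : ∀ x : ℝ, circleMap 0 x (-Real.pi) = circleMap 0 x Real.pi := by
    intro x
    have := periodic_circleMap 0 x (-Real.pi)
    rw [← this]; congr 1; ring
  have h2 : exp (((-Real.pi : ℝ) : ℂ) * I) = exp (((Real.pi : ℝ) : ℂ) * I) := by
    push_cast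
    rw [neg_mul, exp_neg, exp_pi_mul_I]; norm_num
  simp only [h1, h2, sub_self, zero_add]

/-- **Cauchy's integral formula** on an annulus. -/
theorem circleIntegral_div_sub_annulus {H : ℂ → ℂ} {ε r : ℝ} {p : ℂ} (hε : 0 < ε)
    (hp : ε < ‖p‖) (hpr : ‖p‖ < r)
    (hH : ∀ z : ℂ, ε ≤ ‖z‖ → ‖z‖ ≤ r → DifferentiableAt ℂ H z) :
    (∮ z in C(0, r), H z / (z - p)) - (∮ z in C(0, ε), H z / (z - p)) =
      2 * Real.pi * I * H p := by
  have hεr : ε < r := hp.trans hpr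
  have hr : 0 < r := hε.trans hεr
  have hHc : ∀ z : ℂ, ε ≤ ‖z‖ → ‖z‖ ≤ r → ContinuousAt H z := fun z h1 h2 =>
    (hH z h1 h2).continuousAt
  -- The difference quotient of H at p has a removable singularity, so its two circle integrals
  -- agree; only the winding numbers of the circles about p, 1 and 0, remain.
  have hds : (∮ z in C(0, r), dslope H p z) = ∮ z in C(0, ε), dslope H p z := by
    refine circleIntegral_eq_of_differentiable_on_annulus_off_countable hε hεr.le
      (countable_singleton p) ?_ ?_
    · intro z hz
      simp only [Set.mem_sdiff, Metric.mem_closedBall, dist_zero_right, Metric.mem_ball,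
        not_lt] at hz
      refine ContinuousAt.continuousWithinAt ?_
      by_cases hzp : z = p
      · rw [hzp, continuousAt_dslope_same]; exact hH p hp.le hpr.le
      · rw [continuousAt_dslope_of_ne hzp]; exact hHc z hz.2 hz.1
    · intro z hz
      simp only [Set.mem_sdiff, Metric.mem_closedBall, dist_zero_right, Metric.mem_ball, not_le,
        mem_singleton_iff] at hz
      rw [differentiableAt_dslope_of_ne hz.2]
      exact hH z hz.1.2.le hz.1.1.le
  have key : ∀ ρ, ε ≤ ρ → ρ ≤ r → ρ ≠ ‖p‖ → (∮ z in C(0, ρ), H z / (z - p)) =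
      (∮ z in C(0, ρ), dslope H p z) + H p * ∮ z in C(0, ρ), (z - p)⁻¹ := by
    intro ρ h1 h2 h3
    have hρ : 0 ≤ ρ := hε.le.trans h1
    have hne : ∀ z ∈ Metric.sphere (0 : ℂ) ρ, z ≠ p := by
      rintro z hz rfl
      exact h3 (by simpa using hz.symm)
    have hi : ContinuousOn (fun z => (z - p)⁻¹) (Metric.sphere (0 : ℂ) ρ) :=
      ContinuousOn.inv₀ (by fun_prop) fun z hz => sub_ne_zero.2 (hne z hz)
    have hd : ContinuousOn (dslope H p) (Metric.sphere (0 : ℂ) ρ) := by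
      intro z hz
      refine ContinuousAt.continuousWithinAt ?_
      rw [continuousAt_dslope_of_ne (hne z hz)]
      have : ‖z‖ = ρ := by simpa using hz
      exact hHc z (this ▸ h1) (this ▸ h2)
    have h4 : (H p * ∮ z in C(0, ρ), (z - p)⁻¹) = ∮ z in C(0, ρ), H p • (z - p)⁻¹ := by
      rw [circleIntegral.integral_smul, smul_eq_mul]
    rw [h4, ← circleIntegral.integral_add (hd.circleIntegrable hρ)
      (ContinuousOn.circleIntegrable (f := fun z => H p • (z - p)⁻¹) hρ
        (continuousOn_const.mul hi))]
    refine circleIntegral.integral_congr hρ fun z hz => ?_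
    have := sub_ne_zero.2 (hne z hz)
    simp only [dslope_of_ne _ (hne z hz), slope_def_field, smul_eq_mul]
    field_simp
    ring
  have hout : (∮ z in C(0, r), (z - p)⁻¹) = 2 * Real.pi * I :=
    circleIntegral.integral_sub_inv_of_mem_ball (by simpa using hpr)
  have hin : (∮ z in C(0, ε), (z - p)⁻¹) = 0 := by
    refine Complex.circleIntegral_eq_zero_of_differentiable_on_off_countable hε.le
      countable_empty ?_ ?_
    · refine ContinuousOn.inv₀ (by fun_prop) fun z hz h => ?_
      rw [sub_eq_zero.1 h] at hz
      simp at hz; linarith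
    · intro z hz
      refine DifferentiableAt.inv (by fun_prop) fun h => ?_
      rw [sub_eq_zero.1 h] at hz
      simp at hz; linarith
  rw [key r hεr.le le_rfl hpr.ne', key ε le_rfl hεr.le hp.ne, hds, hout, hin]
  ring

/-! ### Control of the inner boundary by integrability -/

/-- An integrable function on a punctured disk has small means on some small circles. -/
theorem frequently_sq_mul_integral_circleMap_lt {g : ℂ → ℂ} {δ : ℝ} (hδ : 0 < δ)
    (hg : ContinuousOn g {z : ℂ | 0 < ‖z‖ ∧ ‖z‖ < δ})
    (hi : IntegrableOn g {z : ℂ | 0 < ‖z‖ ∧ ‖z‖ < δ}) {c : ℝ} (hc : 0 < c) :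
    ∃ᶠ ρ in 𝓝[>] (0 : ℝ),
      ρ ^ 2 * ∫ θ in (-Real.pi)..Real.pi, ‖g (circleMap 0 ρ θ)‖ < c := by
  intro hev
  have hπ : -Real.pi ≤ Real.pi := by linarith [Real.pi_pos]
  obtain ⟨δ', hδ', hsub⟩ := mem_nhdsGT_iff_exists_Ioo_subset.1
    (hev.and (Ioo_mem_nhdsGT hδ))
  have hδ'0 : 0 < δ' := hδ'
  have hcm : Continuous (fun p : ℝ × ℝ => circleMap 0 p.1 p.2) := by
    unfold circleMap; fun_prop
  have hS : MeasurableSet {z : ℂ | 0 < ‖z‖ ∧ ‖z‖ < δ} :=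
    ((isOpen_lt continuous_const continuous_norm).inter
      (isOpen_lt continuous_norm continuous_const)).measurableSet
  have hgc : ContinuousOn (fun p : ℝ × ℝ => g (circleMap 0 p.1 p.2))
      (Ioo 0 δ' ×ˢ Ioo (-Real.pi) Real.pi) := by
    refine hg.comp hcm.continuousOn fun p hp => ?_
    simpa [abs_of_pos hp.1.1, hp.1.1.ne'] using (hsub hp.1).2.2
  have hfin : ∫⁻ p in Ioo 0 δ' ×ˢ Ioo (-Real.pi) Real.pi,
      ENNReal.ofReal p.1 * ‖g (circleMap 0 p.1 p.2)‖ₑ < ⊤ := by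
    refine lt_of_le_of_lt ?_ hi.2
    rw [← lintegral_indicator hS, ← Complex.lintegral_comp_polarCoord_symm,
      ← lintegral_indicator (measurableSet_Ioo.prod measurableSet_Ioo),
      ← lintegral_indicator polarCoord.open_target.measurableSet]
    refine lintegral_mono fun p => ?_
    by_cases hp : p ∈ Ioo 0 δ' ×ˢ Ioo (-Real.pi) Real.pi
    · have h1 : p ∈ polarCoord.target := ⟨hp.1.1, hp.2⟩
      have h2 : circleMap 0 p.1 p.2 ∈ {z : ℂ | 0 < ‖z‖ ∧ ‖z‖ < δ} := by
        simpa [abs_of_pos hp.1.1, hp.1.1.ne'] using (hsub hp.1).2.2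
      rw [indicator_of_mem hp, indicator_of_mem h1, polarCoord_symm_eq_circleMap,
        indicator_of_mem h2, smul_eq_mul]
    · rw [indicator_of_notMem hp]
      exact zero_le
  -- If ρ² times the angular integral stays at least c, the radial density of the area integral is
  -- at least c/ρ.
  have hinner : ∀ ρ ∈ Ioo 0 δ', ENNReal.ofReal (c / ρ) ≤
      ∫⁻ θ in Ioo (-Real.pi) Real.pi, ENNReal.ofReal ρ * ‖g (circleMap 0 ρ θ)‖ₑ := by
    intro ρ hρ
    have h1 : ContinuousOn (fun θ : ℝ => g (circleMap 0 ρ θ)) (Icc (-Real.pi) Real.pi) := by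
      refine hg.comp (continuous_circleMap 0 ρ).continuousOn fun θ _ => ?_
      simpa [abs_of_pos hρ.1, hρ.1.ne'] using (hsub hρ).2.2
    have h2 : IntegrableOn (fun θ : ℝ => g (circleMap 0 ρ θ)) (Ioo (-Real.pi) Real.pi) :=
      (h1.integrableOn_compact isCompact_Icc).mono_set Ioo_subset_Icc_self
    rw [lintegral_const_mul' _ _ ENNReal.ofReal_ne_top,
      ← ofReal_integral_norm_eq_lintegral_enorm h2, ← ENNReal.ofReal_mul hρ.1.le]
    refine ENNReal.ofReal_le_ofReal ?_
    have h3 : ¬(ρ ^ 2 * ∫ θ in (-Real.pi)..Real.pi, ‖g (circleMap 0 ρ θ)‖ < c) := (hsub hρ).1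
    rw [intervalIntegral.integral_of_le hπ, integral_Ioc_eq_integral_Ioo, not_lt] at h3
    rw [div_le_iff₀ hρ.1]
    linarith
  have hfin2 : ∫⁻ ρ in Ioo 0 δ', ENNReal.ofReal (c / ρ) < ⊤ := by
    refine lt_of_le_of_lt (setLIntegral_mono' measurableSet_Ioo hinner) ?_
    rw [Measure.volume_eq_prod, setLIntegral_prod] at hfin
    · exact hfin
    · rw [← Measure.volume_eq_prod]
      exact (by fun_prop : Measurable fun p : ℝ × ℝ => ENNReal.ofReal p.1).aemeasurable.mul
        (hgc.aestronglyMeasurable (measurableSet_Ioo.prod measurableSet_Ioo)).enorm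
  have hint : IntegrableOn (fun ρ : ℝ => c / ρ) (Ioo 0 δ') := by
    refine ⟨(by fun_prop : Measurable fun ρ : ℝ => c / ρ).aestronglyMeasurable, ?_⟩
    rw [hasFiniteIntegral_iff_ofReal]
    · exact hfin2
    · exact (ae_restrict_iff' measurableSet_Ioo).2 (ae_of_all _ fun ρ hρ =>
        (div_pos hc hρ.1).le)
  have hint2 : IntervalIntegrable (fun ρ : ℝ => ρ⁻¹) volume 0 δ' := by
    rw [intervalIntegrable_iff_integrableOn_Ioo_of_le hδ'0.le]
    have := hint.const_mul c⁻¹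
    refine this.congr (ae_of_all _ fun ρ => ?_)
    field_simp
  -- The contradiction: 1/ρ is not integrable up to 0.
  simp [hδ'0.ne, hδ'0.le] at hint2

/-! ### The ζ̄-potential of the spherical density -/

/-- The two-term Laurent polynomial `p ζ + q ζ⁻¹`. -/
def twoTerm (p q : ℝ) (ζ : ℂ) : ℂ := p * ζ + q * ζ⁻¹

/-- The derivative of `twoTerm p q`. -/
def twoTermDeriv (p q : ℝ) (ζ : ℂ) : ℂ := p - q * (ζ ^ 2)⁻¹

/-- The spherical density pulled back by `twoTerm p q`. -/
def twoTermDensity (p q : ℝ) (ζ : ℂ) : ℂ :=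
  (‖twoTermDeriv p q ζ‖ : ℂ) ^ 2 / (1 + (‖twoTerm p q ζ‖ : ℂ) ^ 2) ^ 2

/-- A function whose `∂/∂ζ̄`-derivative is `twoTermDensity p q`. -/
def densityPotential (p q : ℝ) (ζ : ℂ) : ℂ :=
  twoTermDeriv p q ζ * (starRingEnd ℂ) (twoTerm p q ζ) *
    (1 + twoTerm p q ζ * (starRingEnd ℂ) (twoTerm p q ζ))⁻¹ + ζ⁻¹

/-- The middle coefficient of the quadratic polynomial which `ζ²` satisfies at the nodes. -/
def nodeCoeff (p q r : ℝ) : ℝ := r ^ 2 + p ^ 2 * r ^ 4 + q ^ 2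

/-- The square root of the discriminant of the node polynomial. -/
def nodeDisc (p q r : ℝ) : ℝ := √(nodeCoeff p q r ^ 2 - 4 * p ^ 2 * q ^ 2 * r ^ 4)

/-- The modulus of the nodes belonging to the disk of radius `r`. -/
def nodeModulus (p q r : ℝ) : ℝ := √((nodeCoeff p q r - nodeDisc p q r) / (2 * (p * q)))

/-- The weight of the nodes belonging to the disk of radius `r`. -/
def nodeWeight (p q r : ℝ) : ℝ := 1 / 2 + (p ^ 2 * r ^ 4 - q ^ 2) / (2 * nodeDisc p q r)

/-- The rational function that agrees with `densityPotential p q` on the circle of radius `r`. -/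
def circlePotential (p q r : ℝ) (ζ : ℂ) : ℂ :=
  ζ * (2 * p * q * ζ ^ 2 + r ^ 2 + 2 * p ^ 2 * r ^ 4) /
    (p * q * ζ ^ 4 + nodeCoeff p q r * ζ ^ 2 + p * q * r ^ 4)

lemma hasDerivAt_twoTerm (p q : ℝ) {ζ : ℂ} (hζ : ζ ≠ 0) :
    HasDerivAt (twoTerm p q) (twoTermDeriv p q ζ) ζ := by
  have h := ((hasDerivAt_id ζ).const_mul (p : ℂ)).add ((hasDerivAt_inv hζ).const_mul (q : ℂ))
  refine h.congr_deriv ?_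
  simp [twoTermDeriv]; ring

lemma differentiableAt_twoTermDeriv (p q : ℝ) {ζ : ℂ} (hζ : ζ ≠ 0) :
    DifferentiableAt ℂ (twoTermDeriv p q) ζ := by
  unfold twoTermDeriv
  exact (differentiableAt_const _).sub
    (((differentiableAt_id.pow 2).inv (pow_ne_zero 2 hζ)).const_mul _)

lemma one_add_mul_conj_ne_zero (w : ℂ) : 1 + w * (starRingEnd ℂ) w ≠ 0 := by
  rw [mul_conj]
  have : (0 : ℝ) < 1 + normSq w := by linarith [normSq_nonneg w]
  exact_mod_cast this.ne'

lemma continuousAt_twoTermDensity (p q : ℝ) {ζ : ℂ} (hζ : ζ ≠ 0) :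
    ContinuousAt (twoTermDensity p q) ζ := by
  have h1 : ContinuousAt (fun ζ => (‖twoTermDeriv p q ζ‖ : ℂ)) ζ :=
    continuous_ofReal.continuousAt.comp (differentiableAt_twoTermDeriv p q hζ).continuousAt.norm
  have h2 : ContinuousAt (fun ζ => (‖twoTerm p q ζ‖ : ℂ)) ζ :=
    continuous_ofReal.continuousAt.comp (hasDerivAt_twoTerm p q hζ).continuousAt.norm
  refine (h1.pow 2).div ((continuousAt_const.add (h2.pow 2)).pow 2) ?_
  rw [← mul_conj']
  exact pow_ne_zero 2 (one_add_mul_conj_ne_zero _)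

/-- In ∂/∂ζ̄ only the conjugate of f is differentiated, and w̄ ↦ w̄/(1+ww̄) has derivative
1/(1+ww̄)². The dζ-coefficient never matters, so it is left existential. -/
lemma hasFDerivAt_densityPotential (p q : ℝ) {ζ : ℂ} (hζ : ζ ≠ 0) :
    ∃ A, HasFDerivAt (densityPotential p q) (wirtinger A (twoTermDensity p q ζ)) ζ := by
  have hf := HasDerivAt.hasFDerivAt_wirtinger (hasDerivAt_twoTerm p q hζ)
  have hf' := HasDerivAt.hasFDerivAt_wirtinger (differentiableAt_twoTermDeriv p q hζ).hasDerivAt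
  have h1 := HasDerivAt.hasFDerivAt_wirtinger (hasDerivAt_const ζ (1 : ℂ))
  have hc := hasFDerivAt_wirtinger_conj hf
  have hi := HasDerivAt.hasFDerivAt_wirtinger (hasDerivAt_inv hζ)
  have hne := one_add_mul_conj_ne_zero (twoTerm p q ζ)
  have h := hasFDerivAt_wirtinger_add (hasFDerivAt_wirtinger_mul (hasFDerivAt_wirtinger_mul hf' hc)
    (hasFDerivAt_wirtinger_inv (hasFDerivAt_wirtinger_add h1 (hasFDerivAt_wirtinger_mul hf hc))
      hne)) hi
  refine ⟨_, h.congr_fderiv (congrArg _ ?_)⟩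
  rw [twoTermDensity, ← mul_conj', ← mul_conj']
  field_simp
  ring

/-! ### Poles of the rational boundary function -/

section nodes

variable {p q r : ℝ}

/-- The positivity behind all root estimates: with S = `nodeCoeff p q r`, the discriminant is (S -
2pqr²)(S + 2pqr²). -/
lemma nodeCoeff_sub (p q r : ℝ) :
    nodeCoeff p q r - 2 * (p * q) * r ^ 2 = r ^ 2 + (p * r ^ 2 - q) ^ 2 := by
  unfold nodeCoeff; ring

lemma nodeDisc_sq (hp : 0 < p) (hq : 0 < q) :
    nodeDisc p q r ^ 2 = nodeCoeff p q r ^ 2 - 4 * p ^ 2 * q ^ 2 * r ^ 4 := by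
  refine Real.sq_sqrt ?_
  have h1 : 0 ≤ nodeCoeff p q r - 2 * (p * q) * r ^ 2 := by rw [nodeCoeff_sub]; positivity
  have h2 : 0 ≤ nodeCoeff p q r + 2 * (p * q) * r ^ 2 := by unfold nodeCoeff; positivity
  nlinarith [mul_nonneg h1 h2]

lemma nodeDisc_pos (hp : 0 < p) (hq : 0 < q) (hr : 0 < r) : 0 < nodeDisc p q r := by
  have h1 : 0 < nodeCoeff p q r - 2 * (p * q) * r ^ 2 := by rw [nodeCoeff_sub]; positivity
  have h2 : 0 < nodeCoeff p q r + 2 * (p * q) * r ^ 2 := by unfold nodeCoeff; positivity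
  refine Real.sqrt_pos.2 ?_
  nlinarith [mul_pos h1 h2]

lemma nodeDisc_lt (hp : 0 < p) (hq : 0 < q) (hr : 0 < r) : nodeDisc p q r < nodeCoeff p q r := by
  have h : 0 < nodeCoeff p q r := by unfold nodeCoeff; positivity
  refine lt_of_pow_lt_pow_left₀ 2 h.le ?_
  rw [nodeDisc_sq hp hq]
  have : 0 < 4 * p ^ 2 * q ^ 2 * r ^ 4 := by positivity
  linarith

lemma nodeModulus_pos (hp : 0 < p) (hq : 0 < q) (hr : 0 < r) : 0 < nodeModulus p q r :=
  Real.sqrt_pos.2 (div_pos (sub_pos.2 (nodeDisc_lt hp hq hr)) (by positivity))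

lemma nodeModulus_sq (hp : 0 < p) (hq : 0 < q) (hr : 0 < r) :
    nodeModulus p q r ^ 2 = (nodeCoeff p q r - nodeDisc p q r) / (2 * (p * q)) :=
  Real.sq_sqrt (div_pos (sub_pos.2 (nodeDisc_lt hp hq hr)) (by positivity)).le

lemma nodeModulus_lt (hp : 0 < p) (hq : 0 < q) (hr : 0 < r) : nodeModulus p q r < r := by
  refine lt_of_pow_lt_pow_left₀ 2 hr.le ?_
  rw [nodeModulus_sq hp hq hr, div_lt_iff₀ (by positivity)]
  have h1 : 0 < nodeCoeff p q r - 2 * (p * q) * r ^ 2 := by rw [nodeCoeff_sub]; positivity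
  have h2 : nodeCoeff p q r - 2 * (p * q) * r ^ 2 < nodeDisc p q r := by
    refine lt_of_pow_lt_pow_left₀ 2 (nodeDisc_pos hp hq hr).le ?_
    rw [nodeDisc_sq hp hq]
    have : 0 < (p * q) * r ^ 2 := by positivity
    nlinarith [mul_pos this h1]
  linarith

/-- The factor of the node polynomial which does not vanish in the disk. -/
def outerFactor (p q r : ℝ) : ℝ := (nodeCoeff p q r + nodeDisc p q r) / (2 * (p * q))

/-- Vieta for the node polynomial in ζ²: its roots are minus these two factors, so they lie on
opposite sides of the circle |ζ|² = r². -/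
lemma nodeModulus_sq_mul_outerFactor (hp : 0 < p) (hq : 0 < q) (hr : 0 < r) :
    nodeModulus p q r ^ 2 * outerFactor p q r = r ^ 4 := by
  rw [nodeModulus_sq hp hq hr, outerFactor]
  have := nodeDisc_sq (r := r) hp hq
  field_simp
  linear_combination -this

lemma sq_lt_outerFactor (hp : 0 < p) (hq : 0 < q) (hr : 0 < r) : r ^ 2 < outerFactor p q r := by
  rw [outerFactor, lt_div_iff₀ (by positivity)]
  have h1 : 0 < nodeCoeff p q r - 2 * (p * q) * r ^ 2 := by rw [nodeCoeff_sub]; positivity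
  linarith [nodeDisc_pos hp hq hr]

lemma nodePolynomial_eq (hp : 0 < p) (hq : 0 < q) (hr : 0 < r) (w : ℂ) :
    p * q * w ^ 2 + nodeCoeff p q r * w + p * q * r ^ 4 =
      p * q * (w + (nodeModulus p q r : ℂ) ^ 2) * (w + outerFactor p q r) := by
  have h1 : (nodeModulus p q r : ℂ) ^ 2 * outerFactor p q r = (r : ℂ) ^ 4 := by
    exact_mod_cast nodeModulus_sq_mul_outerFactor hp hq hr
  have h2 : p * q * (nodeModulus p q r ^ 2 + outerFactor p q r) = nodeCoeff p q r := by
    rw [nodeModulus_sq hp hq hr, outerFactor]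
    field_simp
    ring
  have h3 : (p : ℂ) * q * ((nodeModulus p q r : ℂ) ^ 2 + outerFactor p q r) =
    nodeCoeff p q r := by exact_mod_cast h2
  linear_combination (-w) * h3 - p * q * h1

lemma densityPotential_eq_circlePotential (hr : 0 < r) {ζ : ℂ} (hζ : ‖ζ‖ = r) :
    densityPotential p q ζ = circlePotential p q r ζ := by
  have hζ0 : ζ ≠ 0 := by rw [← norm_pos_iff, hζ]; exact hr
  have hr0 : (r : ℂ) ≠ 0 := by exact_mod_cast hr.ne'
  have hcz : ζ * (starRingEnd ℂ) ζ = (r : ℂ) ^ 2 := by rw [mul_conj', hζ]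
  have hcj : (starRingEnd ℂ) ζ = (r : ℂ) ^ 2 / ζ := by rw [eq_div_iff hζ0, mul_comm, hcz]
  have hne := one_add_mul_conj_ne_zero (twoTerm p q ζ)
  have hconj : (starRingEnd ℂ) (twoTerm p q ζ) = p * r ^ 2 / ζ + q * ζ / r ^ 2 := by
    simp only [twoTerm, map_add, map_mul, conj_ofReal, map_inv₀, hcj]
    field_simp
  -- On the circle the node polynomial is 1 + |f|² cleared of denominators, so it has no zero there.
  have hD : p * q * ζ ^ 4 + nodeCoeff p q r * ζ ^ 2 + p * q * r ^ 4 =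
      (1 + twoTerm p q ζ * (starRingEnd ℂ) (twoTerm p q ζ)) * (r ^ 2 * ζ ^ 2) := by
    rw [hconj, twoTerm, nodeCoeff]
    push_cast
    field_simp
    ring
  rw [densityPotential, circlePotential, hD]
  rw [eq_div_iff (mul_ne_zero hne (by positivity))]
  have e : ∀ X : ℂ, X ≠ 0 → ∀ Y : ℂ, (Y * X⁻¹ + ζ⁻¹) * (X * (r ^ 2 * ζ ^ 2)) =
      Y * (r ^ 2 * ζ ^ 2) + X * r ^ 2 * ζ := by
    intro X hX Y
    field_simp
  rw [e _ hne, hconj, twoTerm, twoTermDeriv]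
  field_simp
  ring

end nodes

/-! ### Quadrature on the punctured disk -/

/-- The punctured disk of radius `r` about the origin. -/
def puncturedDisk (r : ℝ) : Set ℂ := {ζ | 0 < ‖ζ‖ ∧ ‖ζ‖ < r}

lemma isOpen_puncturedDisk (r : ℝ) : IsOpen (puncturedDisk r) :=
  (isOpen_lt continuous_const continuous_norm).inter (isOpen_lt continuous_norm continuous_const)

variable {p q r : ℝ}

/-- The residue computation on an annulus. -/
lemma circleIntegral_mul_circlePotential_sub {h : ℂ → ℂ} {ε : ℝ} (hp : 0 < p) (hq : 0 < q)
    (hr : 0 < r) (hε : 0 < ε) (hεy : ε < nodeModulus p q r)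
    (hh : ∀ z : ℂ, ε ≤ ‖z‖ → ‖z‖ ≤ r → DifferentiableAt ℂ h z) :
    (∮ z in C(0, r), h z * circlePotential p q r z) -
        (∮ z in C(0, ε), h z * circlePotential p q r z) =
      2 * Real.pi * I * (nodeWeight p q r *
        (h (nodeModulus p q r * I) + h (-(nodeModulus p q r * I)))) := by
  set y := nodeModulus p q r with hy
  have hy0 : 0 < y := nodeModulus_pos hp hq hr
  have hyr : y < r := nodeModulus_lt hp hq hr
  set Y := outerFactor p q r with hY
  have hrY : r ^ 2 < Y := sq_lt_outerFactor hp hq hr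
  have hpq : (p : ℂ) * q ≠ 0 := by exact_mod_cast (mul_pos hp hq).ne'
  have hYne : ∀ z : ℂ, ‖z‖ ≤ r → z ^ 2 + (Y : ℂ) ≠ 0 := by
    intro z hz h0
    have h1 : z ^ 2 = -(Y : ℂ) := by linear_combination h0
    have h2 : ‖z‖ ^ 2 = Y := by
      rw [← norm_pow, h1, norm_neg, norm_real, Real.norm_of_nonneg ((sq_nonneg r).trans hrY.le)]
    nlinarith [norm_nonneg z]
  -- From z/(z²+y²) = ½(1/(z-iy) + 1/(z+iy)): the factor ½ goes into `H`, which is holomorphic on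
  -- the annulus, and h·R = `H`/(z-iy) + `H`/(z+iy).
  set H : ℂ → ℂ := fun z =>
    h z * ((2 * p * q * z ^ 2 + r ^ 2 + 2 * p ^ 2 * r ^ 4) / (2 * (p * q * (z ^ 2 + Y)))) with hH
  have hHd : ∀ z : ℂ, ε ≤ ‖z‖ → ‖z‖ ≤ r → DifferentiableAt ℂ H z := by
    intro z h1 h2
    refine (hh z h1 h2).mul (DifferentiableAt.div (by fun_prop) (by fun_prop) ?_)
    exact mul_ne_zero two_ne_zero (mul_ne_zero hpq (hYne z h2))
  have hnorm : ‖(y : ℂ) * I‖ = y := by simp [abs_of_pos hy0]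
  have c1 := circleIntegral_div_sub_annulus (p := y * I) hε (by rwa [hnorm]) (by rwa [hnorm]) hHd
  have c2 := circleIntegral_div_sub_annulus (p := -(y * I)) hε (by rwa [norm_neg, hnorm])
    (by rwa [norm_neg, hnorm]) hHd
  have hint : ∀ ρ, ε ≤ ρ → ρ ≤ r → ρ ≠ y → (∮ z in C(0, ρ), h z * circlePotential p q r z) =
      (∮ z in C(0, ρ), H z / (z - y * I)) + ∮ z in C(0, ρ), H z / (z - -(y * I)) := by
    intro ρ h1 h2 h3
    have hρ : 0 ≤ ρ := hε.le.trans h1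
    have hsph : ∀ z ∈ Metric.sphere (0 : ℂ) ρ, ‖z‖ = ρ := fun z hz => by simpa using hz
    have hne1 : ∀ z ∈ Metric.sphere (0 : ℂ) ρ, z - y * I ≠ 0 := fun z hz h0 => by
      have := hsph z hz
      rw [sub_eq_zero.1 h0, hnorm] at this
      exact h3 this.symm
    have hne2 : ∀ z ∈ Metric.sphere (0 : ℂ) ρ, z - -(y * I) ≠ 0 := fun z hz h0 => by
      have := hsph z hz
      rw [sub_eq_zero.1 h0, norm_neg, hnorm] at this
      exact h3 this.symm
    have hHc : ContinuousOn H (Metric.sphere (0 : ℂ) ρ) := fun z hz =>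
      (hHd z (by rwa [hsph z hz]) (by rwa [hsph z hz])).continuousAt.continuousWithinAt
    rw [← circleIntegral.integral_add
      (ContinuousOn.circleIntegrable (f := fun z => H z / (z - y * I)) hρ
        (hHc.div (by fun_prop) hne1))
      (ContinuousOn.circleIntegrable (f := fun z => H z / (z - -(y * I))) hρ
        (hHc.div (by fun_prop) hne2))]
    refine circleIntegral.integral_congr hρ fun z hz => ?_
    have e1 := hne1 z hz
    have e2 := hne2 z hz
    have e3 := hYne z (by rwa [hsph z hz])
    have e4 : z ^ 2 + (y : ℂ) ^ 2 = (z - y * I) * (z - -(y * I)) := by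
      linear_combination (y : ℂ) ^ 2 * I_sq
    have e5 := nodePolynomial_eq hp hq hr (z ^ 2)
    rw [← hy, ← hY, e4, ← pow_mul] at e5
    simp only [hH, circlePotential]
    rw [e5]
    field_simp
    ring
  -- Apart from h, `H` depends on z² only, which is why both nodes carry the same weight.
  have hw : ∀ s : ℂ, s ^ 2 = -(y : ℂ) ^ 2 → H s = nodeWeight p q r * h s := by
    intro s hs
    have hT := nodeDisc_pos hp hq hr
    have hp0 : (p : ℂ) ≠ 0 := left_ne_zero_of_mul hpq
    have hq0 : (q : ℂ) ≠ 0 := right_ne_zero_of_mul hpq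
    have h1 : (y : ℂ) ^ 2 = (nodeCoeff p q r - nodeDisc p q r) / (2 * (p * q)) := by
      exact_mod_cast nodeModulus_sq hp hq hr
    have h2 : (p : ℂ) * q * (-(y : ℂ) ^ 2 + Y) = nodeDisc p q r := by
      rw [h1, hY, outerFactor]
      push_cast
      field_simp
      ring
    have h3 : 2 * p * q * (y : ℂ) ^ 2 = nodeCoeff p q r - nodeDisc p q r := by
      rw [h1]; field_simp
    have hTc : (nodeDisc p q r : ℂ) ≠ 0 := by exact_mod_cast hT.ne'
    simp only [hH, hs, h2, nodeWeight]
    rw [mul_neg, h3, nodeCoeff]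
    push_cast
    field_simp
    ring
  rw [hint r (hεy.trans hyr).le le_rfl hyr.ne', hint ε le_rfl (hεy.trans hyr).le hεy.ne]
  rw [hw (y * I) (by linear_combination (y : ℂ) ^ 2 * I_sq)] at c1
  rw [hw (-(y * I)) (by linear_combination (y : ℂ) ^ 2 * I_sq)] at c2
  linear_combination c1 + c2

/-- One factor ρ comes from arc length and one from the O(ρ) bound on the kernel; together they give
the ρ² that integrability can absorb. -/
lemma norm_circleIntegral_le_sq_mul {K g : ℂ → ℂ} {C ρ : ℝ} (hρ : 0 < ρ)
    (hg : ContinuousOn g (Metric.sphere 0 ρ))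
    (hK : ∀ z : ℂ, ‖z‖ = ρ → ‖K z‖ ≤ C * ρ * ‖g z‖) :
    ‖∮ z in C(0, ρ), K z‖ ≤
      C * (ρ ^ 2 * ∫ θ in (-Real.pi)..Real.pi, ‖g (circleMap 0 ρ θ)‖) := by
  have hπ : -Real.pi ≤ Real.pi := by linarith [Real.pi_pos]
  have hcm : ∀ θ, ‖circleMap 0 ρ θ‖ = ρ := fun θ => by simp [abs_of_pos hρ]
  rw [circleIntegral_eq_integral_neg_pi_pi, ← mul_assoc, ← intervalIntegral.integral_const_mul]
  refine intervalIntegral.norm_integral_le_of_norm_le hπ (ae_of_all _ fun θ _ => ?_) ?_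
  · rw [norm_mul, norm_mul, norm_I, one_mul, hcm]
    have := hK _ (hcm θ)
    calc _ ≤ ρ * (C * ρ * ‖g (circleMap 0 ρ θ)‖) := by gcongr
      _ = _ := by ring
  · refine Continuous.intervalIntegrable ?_ _ _
    refine continuous_const.mul (Continuous.norm ?_)
    exact hg.comp_continuous (continuous_circleMap 0 ρ) fun θ => by simp [abs_of_pos hρ]

lemma eventually_norm_circlePotential_le (hp : 0 < p) (hq : 0 < q) (hr : 0 < r) :
    ∃ C, 0 < C ∧ ∀ᶠ z : ℂ in 𝓝 0, ‖circlePotential p q r z‖ ≤ C * ‖z‖ := by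
  set G : ℂ → ℂ := fun ζ => (2 * p * q * ζ ^ 2 + r ^ 2 + 2 * p ^ 2 * r ^ 4) /
    (p * q * ζ ^ 4 + nodeCoeff p q r * ζ ^ 2 + p * q * r ^ 4) with hG
  have hc : ContinuousAt G 0 := by
    refine ContinuousAt.div (by fun_prop) (by fun_prop) ?_
    have : p * q * r ^ 4 ≠ 0 := by positivity
    have h2 : (p : ℂ) * q * r ^ 4 ≠ 0 := by exact_mod_cast this
    simpa using h2
  refine ⟨‖G 0‖ + 1, by positivity, ?_⟩
  filter_upwards [hc.norm.eventually_lt_const (lt_add_one ‖G 0‖)] with z hz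
  rw [circlePotential, mul_div_assoc, norm_mul, mul_comm]
  exact mul_le_mul_of_nonneg_right hz.le (norm_nonneg z)

/-- On each small circle the potential is the rational function for that same radius ρ: its
numerator is O(ρ³) and its denominator is at least (q²/4)ρ². -/
lemma eventually_norm_densityPotential_le (hp : 0 < p) (hq : 0 < q) :
    ∃ C, 0 < C ∧ ∀ᶠ ρ in 𝓝[>] (0 : ℝ), ∀ z : ℂ, ‖z‖ = ρ →
      ‖densityPotential p q z‖ ≤ C * ‖z‖ := by
  refine ⟨(2 * p * q + 1 + p * q) / (q ^ 2 / 4), by positivity, ?_⟩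
  have hev : ∀ᶠ ρ in 𝓝 (0 : ℝ), p * ρ ^ 2 < q / 2 := by
    have : ContinuousAt (fun ρ : ℝ => p * ρ ^ 2) 0 := by fun_prop
    exact this.tendsto.eventually_lt_const (by simpa using hq)
  filter_upwards [self_mem_nhdsWithin, nhdsWithin_le_nhds hev] with ρ hρ hlt z hz
  have hρ0 : 0 < ρ := hρ
  have hS := nodeCoeff_sub p q ρ
  have hSpos : 0 < nodeCoeff p q ρ := by unfold nodeCoeff; positivity
  rw [densityPotential_eq_circlePotential hρ0 hz, circlePotential, norm_div, norm_mul, hz]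
  have hnum : ‖2 * p * q * z ^ 2 + ρ ^ 2 + 2 * p ^ 2 * ρ ^ 4‖ ≤
      (2 * p * q + 1 + p * q) * ρ ^ 2 := by
    refine norm_add₃_le.trans ?_
    simp only [norm_mul, norm_pow, norm_real, hz, Real.norm_of_nonneg hp.le,
      Real.norm_of_nonneg hq.le, Real.norm_of_nonneg hρ0.le, RCLike.norm_ofNat]
    nlinarith [mul_pos hp (pow_pos hρ0 2), mul_pos (mul_pos hp (pow_pos hρ0 2)) (sub_pos.2 hlt)]
  have hden : q ^ 2 / 4 * ρ ^ 2 ≤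
      ‖p * q * z ^ 4 + nodeCoeff p q ρ * z ^ 2 + p * q * (ρ : ℂ) ^ 4‖ := by
    have h1 : ‖(nodeCoeff p q ρ : ℂ) * z ^ 2‖ = nodeCoeff p q ρ * ρ ^ 2 := by
      rw [norm_mul, norm_pow, hz, norm_real, Real.norm_of_nonneg hSpos.le]
    have h2 : ‖(p : ℂ) * q * z ^ 4‖ = p * q * ρ ^ 4 := by
      simp only [norm_mul, norm_pow, norm_real, hz, Real.norm_of_nonneg hp.le,
        Real.norm_of_nonneg hq.le]
    have h3 : ‖(p : ℂ) * q * (ρ : ℂ) ^ 4‖ = p * q * ρ ^ 4 := by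
      simp only [norm_mul, norm_pow, norm_real, Real.norm_of_nonneg hρ0.le,
        Real.norm_of_nonneg hp.le, Real.norm_of_nonneg hq.le]
    have h4 : ‖(nodeCoeff p q ρ : ℂ) * z ^ 2‖ ≤
        ‖p * q * z ^ 4 + nodeCoeff p q ρ * z ^ 2 + p * q * (ρ : ℂ) ^ 4‖ +
          ‖(p : ℂ) * q * z ^ 4‖ + ‖(p : ℂ) * q * (ρ : ℂ) ^ 4‖ := by
      refine le_trans (le_of_eq (congrArg norm ?_)) ((norm_sub_le _ _).trans
        (add_le_add_left (norm_sub_le _ _) _))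
      ring
    rw [h1, h2, h3] at h4
    have h5 : q ^ 2 / 4 ≤ nodeCoeff p q ρ - 2 * (p * q) * ρ ^ 2 := by
      rw [hS]; nlinarith [sq_nonneg ρ]
    nlinarith [mul_le_mul_of_nonneg_right h5 (sq_nonneg ρ)]
  have hden0 : 0 < q ^ 2 / 4 * ρ ^ 2 := by positivity
  calc _ ≤ ρ * ((2 * p * q + 1 + p * q) * ρ ^ 2) / (q ^ 2 / 4 * ρ ^ 2) := by gcongr
    _ = _ := by field_simp

/-- The spherical density of `twoTerm p q` is bounded below near its pole. -/
lemma eventually_le_norm_twoTermDensity (p : ℝ) (hq : 0 < q) :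
    ∃ c, 0 < c ∧ ∀ᶠ ρ in 𝓝[>] (0 : ℝ), ∀ z : ℂ, ‖z‖ = ρ → c ≤ ‖twoTermDensity p q z‖ := by
  -- Multiplying numerator and denominator of the density by |z|⁴ removes the pole; the value at 0
  -- is 1/q², and half of it serves as lower bound.
  set G : ℂ → ℝ := fun z => ‖(p : ℂ) * z ^ 2 - q‖ ^ 2 / (‖z‖ ^ 2 + ‖(p : ℂ) * z ^ 2 + q‖ ^ 2) ^ 2
    with hG
  have hG0 : G 0 = 1 / q ^ 2 := by
    simp [hG, abs_of_pos hq]; field_simp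
  have hGc : ContinuousAt G 0 := by
    refine ContinuousAt.div (by fun_prop) (by fun_prop) ?_
    simp [hq.ne']
  have hlt : 1 / (2 * q ^ 2) < G 0 := by
    rw [hG0]
    exact one_div_lt_one_div_of_lt (by positivity) (by nlinarith [pow_pos hq 2])
  refine ⟨1 / (2 * q ^ 2), by positivity, ?_⟩
  obtain ⟨δ, hδ, hball⟩ := Metric.eventually_nhds_iff.1 (hGc.tendsto.eventually_const_lt hlt)
  filter_upwards [Ioo_mem_nhdsGT hδ] with ρ hρ z hz
  have hz0 : z ≠ 0 := by rw [← norm_pos_iff, hz]; exact hρ.1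
  have hGz : ‖twoTermDensity p q z‖ = G z := by
    have e1 : twoTermDeriv p q z = ((p : ℂ) * z ^ 2 - q) / z ^ 2 := by
      rw [twoTermDeriv]; field_simp
    have e2 : twoTerm p q z = ((p : ℂ) * z ^ 2 + q) / z := by
      rw [twoTerm]; field_simp
    have e3 : twoTermDensity p q z = ((‖twoTermDeriv p q z‖ ^ 2 /
      (1 + ‖twoTerm p q z‖ ^ 2) ^ 2 : ℝ) : ℂ) := by rw [twoTermDensity]; push_cast; rfl
    have hz1 : ‖z‖ ≠ 0 := norm_ne_zero_iff.2 hz0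
    have hne : ‖z‖ ^ 2 + ‖(p : ℂ) * z ^ 2 + q‖ ^ 2 ≠ 0 := by positivity
    rw [e3, norm_real, Real.norm_of_nonneg (by positivity), e1, e2, norm_div, norm_div, norm_pow,
      hG]
    field_simp
  rw [hGz]
  exact (hball (by simpa [hz] using hρ.2)).le


/-- The quadrature identity on a punctured disk of radius less than one. -/
theorem setIntegral_puncturedDisk_of_lt_one {h : ℂ → ℂ} (hp : 0 < p) (hq : 0 < q) (hr : 0 < r)
    (hr1 : r < 1) (hh : DifferentiableOn ℂ h (puncturedDisk 1))
    (hi : IntegrableOn (fun z => h z * twoTermDensity p q z) (puncturedDisk 1)) :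
    ∫ z in puncturedDisk r, h z * twoTermDensity p q z =
      Real.pi * (nodeWeight p q r *
        (h (nodeModulus p q r * I) + h (-(nodeModulus p q r * I)))) := by
  set B : ℂ → ℂ := fun z => h z * twoTermDensity p q z with hB
  set X : ℂ := Real.pi * (nodeWeight p q r *
        (h (nodeModulus p q r * I) + h (-(nodeModulus p q r * I)))) with hX
  have hhd : ∀ z : ℂ, 0 < ‖z‖ → ‖z‖ < 1 → DifferentiableAt ℂ h z := fun z h1 h2 =>
    hh.differentiableAt ((isOpen_puncturedDisk 1).mem_nhds ⟨h1, h2⟩)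
  have hBc : ContinuousOn B (puncturedDisk 1) := fun z hz =>
    ((hhd z hz.1 hz.2).continuousAt.mul
      (continuousAt_twoTermDensity p q (norm_pos_iff.1 hz.1))).continuousWithinAt
  -- Stokes for hK minus the residue formula for hR: the outer circles cancel, and the error lives
  -- on the inner circle.
  have hstokes : ∀ ε, 0 < ε → ε < nodeModulus p q r →
      2 * I * (∫ z in {z : ℂ | ε < ‖z‖ ∧ ‖z‖ < r}, B z) - 2 * I * X =
        (∮ z in C(0, ε), h z * circlePotential p q r z) -
          ∮ z in C(0, ε), h z * densityPotential p q z := by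
    intro ε hε hεy
    have hεr : ε < r := hεy.trans (nodeModulus_lt hp hq hr)
    have hex : ∀ z : ℂ, ∃ A, ε ≤ ‖z‖ → ‖z‖ ≤ r →
        HasFDerivAt (fun z => h z * densityPotential p q z) (wirtinger A (B z)) z := by
      intro z
      by_cases hz : ε ≤ ‖z‖ ∧ ‖z‖ ≤ r
      · have hz0 : 0 < ‖z‖ := hε.trans_le hz.1
        obtain ⟨A, hA⟩ := hasFDerivAt_densityPotential p q (norm_pos_iff.1 hz0)
        have h1 := hasFDerivAt_wirtinger_mul (HasDerivAt.hasFDerivAt_wirtinger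
          (hhd z hz0 (hz.2.trans_lt hr1)).hasDerivAt) hA
        rw [mul_zero, add_zero] at h1
        exact ⟨_, fun _ _ => h1⟩
      · exact ⟨0, fun h1 h2 => absurd ⟨h1, h2⟩ hz⟩
    choose A hA using hex
    have h1 := integral_annulus_eq_circleIntegral_sub hε hεr.le hA
      (hBc.mono fun z hz => ⟨hε.trans_le hz.1, hz.2.trans_lt hr1⟩)
    have h2 := circleIntegral_mul_circlePotential_sub hp hq hr hε hεy
      (fun z h1 h2 => hhd z (hε.trans_le h1) (h2.trans_lt hr1))
    have h3 : (∮ z in C(0, r), h z * densityPotential p q z) =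
        ∮ z in C(0, r), h z * circlePotential p q r z :=
      circleIntegral.integral_congr hr.le fun z hz => by
        simp only [densityPotential_eq_circlePotential hr (by simpa using hz)]
    rw [h1, h3, hX]
    linear_combination h2
  obtain ⟨C₁, hC₁, hev₁⟩ := eventually_norm_circlePotential_le hp hq hr
  obtain ⟨C₂, hC₂, hev₂⟩ := eventually_norm_densityPotential_le hp hq
  obtain ⟨c, hc, hev₃⟩ := eventually_le_norm_twoTermDensity p hq
  obtain ⟨δ, hδ, hball⟩ := Metric.eventually_nhds_iff.1 hev₁
  have hbound : ∀ᶠ ε in 𝓝[>] (0 : ℝ),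
      ‖2 * I * (∫ z in {z : ℂ | ε < ‖z‖ ∧ ‖z‖ < r}, B z) - 2 * I * X‖ ≤
        (C₁ + C₂) / c * (ε ^ 2 * ∫ θ in (-Real.pi)..Real.pi, ‖B (circleMap 0 ε θ)‖) := by
    filter_upwards [hev₂, hev₃, Ioo_mem_nhdsGT hδ, Ioo_mem_nhdsGT (nodeModulus_pos hp hq hr)]
      with ε h2 h3 h4 h5
    have hε1 : ε < 1 := (h5.2.trans (nodeModulus_lt hp hq hr)).trans hr1
    have hBs : ContinuousOn B (Metric.sphere 0 ε) := hBc.mono fun z hz => by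
      have : ‖z‖ = ε := by simpa using hz
      exact ⟨this ▸ h5.1, this ▸ hε1⟩
    have hhB : ∀ z : ℂ, ‖z‖ = ε → ‖h z‖ ≤ ‖B z‖ / c := fun z hz => by
      rw [le_div_iff₀ hc, hB, norm_mul]
      exact mul_le_mul_of_nonneg_left (h3 z hz) (norm_nonneg _)
    rw [hstokes ε h5.1 h5.2]
    have k1 := norm_circleIntegral_le_sq_mul (C := C₁ / c) h5.1 hBs
      (K := fun z => h z * circlePotential p q r z) fun z hz => by
        rw [norm_mul]
        have := hball (y := z) (by simpa [hz] using h4.2)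
        rw [hz] at this
        calc _ ≤ ‖B z‖ / c * (C₁ * ε) := by gcongr; exact hhB z hz
          _ = _ := by ring
    have k2 := norm_circleIntegral_le_sq_mul (C := C₂ / c) h5.1 hBs
      (K := fun z => h z * densityPotential p q z) fun z hz => by
        rw [norm_mul]
        have := h2 z hz
        rw [hz] at this
        calc _ ≤ ‖B z‖ / c * (C₂ * ε) := by gcongr; exact hhB z hz
          _ = _ := by ring
    calc _ ≤ _ := norm_sub_le _ _
      _ ≤ _ := add_le_add k1 k2
      _ = _ := by ring
  have hir : IntegrableOn B (puncturedDisk r) := hi.mono_set fun z hz => ⟨hz.1, hz.2.trans hr1⟩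
  have hlim : Tendsto (fun ε : ℝ => ∫ z in {z : ℂ | ε < ‖z‖ ∧ ‖z‖ < r}, B z) (𝓝[>] 0)
      (𝓝 (∫ z in puncturedDisk r, B z)) := by
    have hcov : AECover (volume.restrict (puncturedDisk r)) (𝓝[>] (0 : ℝ))
        (fun ε => {z : ℂ | ε < ‖z‖}) := by
      refine ⟨?_, fun ε => (isOpen_lt continuous_const continuous_norm).measurableSet⟩
      refine (ae_restrict_iff' (isOpen_puncturedDisk r).measurableSet).2
        (ae_of_all _ fun z hz => ?_)
      filter_upwards [Ioo_mem_nhdsGT hz.1] with ε hε using hε.2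
    refine (hcov.integral_tendsto_of_countably_generated hir).congr' ?_
    filter_upwards [self_mem_nhdsWithin] with ε hε
    rw [Measure.restrict_restrict (isOpen_lt continuous_const continuous_norm).measurableSet]
    congr 2
    ext z
    exact ⟨fun hz => ⟨hz.1, hz.2.2⟩, fun hz => ⟨hz.1, (lt_trans hε hz.1 : (0 : ℝ) < ‖z‖), hz.2⟩⟩
  have hlim2 : Tendsto (fun ε : ℝ =>
      ‖2 * I * (∫ z in {z : ℂ | ε < ‖z‖ ∧ ‖z‖ < r}, B z) - 2 * I * X‖)
      (𝓝[>] 0) (𝓝 ‖2 * I * (∫ z in puncturedDisk r, B z) - 2 * I * X‖) :=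
    ((hlim.const_mul _).sub_const _).norm
  -- The error converges as ε → 0, so smallness for arbitrarily small ε, rather than for all of
  -- them, already forces the limit to vanish.
  have hzero : ‖2 * I * (∫ z in puncturedDisk r, B z) - 2 * I * X‖ ≤ 0 := by
    by_contra! hpos
    set d := ‖2 * I * (∫ z in puncturedDisk r, B z) - 2 * I * X‖ with hd
    have hCc : 0 < (C₁ + C₂) / c := by positivity
    have hfr := frequently_sq_mul_integral_circleMap_lt one_pos hBc hi
      (c := d / 2 / ((C₁ + C₂) / c)) (by positivity)
    obtain ⟨ε, e1, e2, e3⟩ := (hfr.and_eventually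
      (hbound.and (hlim2.eventually_const_lt (half_lt_self hpos)))).exists
    rw [lt_div_iff₀ hCc] at e1
    linarith
  have h0 := sub_eq_zero.1 (norm_le_zero_iff.1 hzero)
  exact mul_left_cancel₀ (mul_ne_zero two_ne_zero I_ne_zero) h0

/-- The quadrature identity on the punctured unit disk. -/
theorem setIntegral_puncturedDisk_one {h : ℂ → ℂ} (hp : 0 < p) (hq : 0 < q)
    (hh : DifferentiableOn ℂ h (puncturedDisk 1))
    (hi : IntegrableOn (fun z => h z * twoTermDensity p q z) (puncturedDisk 1)) :
    ∫ z in puncturedDisk 1, h z * twoTermDensity p q z =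
      Real.pi * (nodeWeight p q 1 *
        (h (nodeModulus p q 1 * I) + h (-(nodeModulus p q 1 * I)))) := by
  have hlim : Tendsto (fun r : ℝ => ∫ z in puncturedDisk r, h z * twoTermDensity p q z) (𝓝[<] 1)
      (𝓝 (∫ z in puncturedDisk 1, h z * twoTermDensity p q z)) := by
    have hcov : AECover (volume.restrict (puncturedDisk 1)) (𝓝[<] (1 : ℝ)) puncturedDisk := by
      refine ⟨?_, fun r => (isOpen_puncturedDisk r).measurableSet⟩
      refine (ae_restrict_iff' (isOpen_puncturedDisk 1).measurableSet).2
        (ae_of_all _ fun z hz => ?_)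
      filter_upwards [Ioo_mem_nhdsLT hz.2] with r hr using ⟨hz.1, hr.1⟩
    refine (hcov.integral_tendsto_of_countably_generated hi).congr' ?_
    filter_upwards [self_mem_nhdsWithin] with r hr
    rw [Measure.restrict_restrict (isOpen_puncturedDisk r).measurableSet]
    congr 2
    exact inter_eq_left.2 fun z hz => ⟨hz.1, hz.2.trans hr⟩
  have hdisc : ContinuousAt (nodeDisc p q) 1 := by
    unfold nodeDisc nodeCoeff; fun_prop
  have hmod : ContinuousAt (nodeModulus p q) 1 := by
    have : ContinuousAt (nodeCoeff p q) 1 := by unfold nodeCoeff; fun_prop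
    exact ((this.sub hdisc).div_const _).sqrt
  have hwt : ContinuousAt (nodeWeight p q) 1 := by
    unfold nodeWeight
    refine continuousAt_const.add (ContinuousAt.div (by fun_prop) (continuousAt_const.mul hdisc) ?_)
    exact (mul_pos two_pos (nodeDisc_pos hp hq one_pos)).ne'
  have hnode : ContinuousAt (fun r => (nodeModulus p q r : ℂ) * I) 1 :=
    (continuous_ofReal.continuousAt.comp hmod).mul continuousAt_const
  have hnorm : ‖(nodeModulus p q 1 : ℂ) * I‖ = nodeModulus p q 1 := by
    simp [abs_of_pos (nodeModulus_pos hp hq one_pos)]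
  have hmem : (nodeModulus p q 1 : ℂ) * I ∈ puncturedDisk 1 := by
    rw [puncturedDisk, mem_ofPred_eq, hnorm]
    exact ⟨nodeModulus_pos hp hq one_pos, nodeModulus_lt hp hq one_pos⟩
  have hmem' : -((nodeModulus p q 1 : ℂ) * I) ∈ puncturedDisk 1 := by
    simpa only [puncturedDisk, mem_ofPred_eq, norm_neg] using hmem
  have hc : ∀ z ∈ puncturedDisk 1, ContinuousAt h z := fun z hz =>
    (hh.differentiableAt ((isOpen_puncturedDisk 1).mem_nhds hz)).continuousAt
  -- The nodes at r = 1 are interior points of the punctured disk, so h is continuous there and the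
  -- right-hand side passes to the limit.
  have hlim2 : ContinuousAt (fun r => (Real.pi : ℂ) * ((nodeWeight p q r : ℂ) *
      (h (nodeModulus p q r * I) + h (-(nodeModulus p q r * I))))) 1 := by
    refine continuousAt_const.mul ((continuous_ofReal.continuousAt.comp hwt).mul (.add ?_ ?_))
    · exact ContinuousAt.comp (f := fun r => (nodeModulus p q r : ℂ) * I) (hc _ hmem) hnode
    · exact ContinuousAt.comp (f := fun r => -((nodeModulus p q r : ℂ) * I)) (hc _ hmem') hnode.neg
  refine tendsto_nhds_unique (hlim.congr' ?_) (hlim2.tendsto.mono_left nhdsWithin_le_nhds)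
  filter_upwards [Ioo_mem_nhdsLT zero_lt_one] with r hr
  exact setIntegral_puncturedDisk_of_lt_one hp hq hr.1 hr.2 hh hi

/-! ### Holomorphic change of variables -/

section changeOfVariables

lemma det_wirtinger_zero (A : ℂ) : (wirtinger A 0).det = ‖A‖ ^ 2 := by
  have h : ((wirtinger A 0 : ℂ →L[ℝ] ℂ) : ℂ →ₗ[ℝ] ℂ) = LinearMap.mulLeft ℝ A := by
    ext; simp
  rw [ContinuousLinearMap.det, h, ← normSq_eq_norm_sq, ← Algebra.norm_complex_apply,
    Algebra.norm_apply]
  rfl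

variable {f f' : ℂ → ℂ} {s : Set ℂ}

/-- Change of variables under an injective holomorphic map. -/
lemma setIntegral_image_of_hasDerivAt (hs : MeasurableSet s)
    (hf : ∀ z ∈ s, HasDerivAt f (f' z) z) (hinj : InjOn f s) (g : ℂ → ℂ) :
    ∫ w in f '' s, g w = ∫ z in s, (‖f' z‖ : ℂ) ^ 2 * g (f z) := by
  rw [integral_image_eq_integral_abs_det_fderiv_smul volume hs
    (fun z hz => (HasDerivAt.hasFDerivAt_wirtinger (hf z hz)).hasFDerivWithinAt) hinj]
  simp [det_wirtinger_zero]

lemma integrableOn_image_iff_of_hasDerivAt (hs : MeasurableSet s)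
    (hf : ∀ z ∈ s, HasDerivAt f (f' z) z) (hinj : InjOn f s) (g : ℂ → ℂ) :
    IntegrableOn g (f '' s) ↔ IntegrableOn (fun z => (‖f' z‖ : ℂ) ^ 2 * g (f z)) s := by
  rw [integrableOn_image_iff_integrableOn_abs_det_fderiv_smul volume hs
    (fun z hz => (HasDerivAt.hasFDerivAt_wirtinger (hf z hz)).hasFDerivWithinAt) hinj]
  simp [det_wirtinger_zero]

end changeOfVariables

/-! ### Inversion and the exterior of the disk -/

section inversion

variable (p q : ℝ)

lemma isOpen_diskExterior : IsOpen diskExterior := isOpen_lt continuous_const continuous_norm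

lemma inv_image_puncturedDisk : (fun z : ℂ => z⁻¹) '' puncturedDisk 1 = diskExterior := by
  ext w
  constructor
  · rintro ⟨z, hz, rfl⟩
    simpa [diskExterior] using (one_lt_inv₀ hz.1).2 hz.2
  · intro hw
    have hw1 : 1 < ‖w‖ := hw
    refine ⟨w⁻¹, ⟨?_, ?_⟩, inv_inv w⟩
    · rw [norm_inv]; positivity
    · rw [norm_inv]; exact inv_lt_one_of_one_lt₀ hw1

lemma density_inv {z : ℂ} (hz : z ≠ 0) :
    (‖-(z ^ 2)⁻¹‖ : ℂ) ^ 2 * twoTermDensity p q z⁻¹ = twoTermDensity q p z := by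
  have h1 : twoTerm p q z⁻¹ = twoTerm q p z := by
    simp [twoTerm, add_comm]
  have h2 : ‖-(z ^ 2)⁻¹‖ * ‖twoTermDeriv p q z⁻¹‖ = ‖twoTermDeriv q p z‖ := by
    rw [← norm_mul]
    congr 1
    simp only [twoTermDeriv]
    field_simp
    ring
  rw [twoTermDensity, twoTermDensity, h1, ← h2]
  push_cast
  ring

/-- The quadrature identity on the exterior of the unit disk. -/
theorem setIntegral_diskExterior {p q : ℝ} {h : ℂ → ℂ} (hp : 0 < p) (hq : 0 < q)
    (hh : DifferentiableOn ℂ h diskExterior)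
    (hi : IntegrableOn (fun z => h z * twoTermDensity p q z) diskExterior) :
    ∫ z in diskExterior, h z * twoTermDensity p q z =
      Real.pi * (nodeWeight q p 1 *
        (h ((nodeModulus q p 1)⁻¹ * I) + h (-((nodeModulus q p 1)⁻¹ * I)))) := by
  have hne : ∀ z ∈ puncturedDisk 1, z ≠ 0 := fun z hz => norm_pos_iff.1 hz.1
  have hm := (isOpen_puncturedDisk 1).measurableSet
  have hd : ∀ z ∈ puncturedDisk 1, HasDerivAt (fun z : ℂ => z⁻¹) (-(z ^ 2)⁻¹) z :=
    fun z hz => hasDerivAt_inv (hne z hz)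
  have hinj : InjOn (fun z : ℂ => z⁻¹) (puncturedDisk 1) := inv_injective.injOn
  have heq : EqOn (fun z => (‖-(z ^ 2)⁻¹‖ : ℂ) ^ 2 * (h z⁻¹ * twoTermDensity p q z⁻¹))
      (fun z => h z⁻¹ * twoTermDensity q p z) (puncturedDisk 1) := fun z hz => by
    simp only [← density_inv p q (hne z hz)]
    ring
  have hmaps : MapsTo (fun z : ℂ => z⁻¹) (puncturedDisk 1) diskExterior := by
    rw [← inv_image_puncturedDisk]; exact mapsTo_image _ _
  rw [← inv_image_puncturedDisk, integrableOn_image_iff_of_hasDerivAt hm hd hinj,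
    integrableOn_congr_fun heq hm] at hi
  rw [← inv_image_puncturedDisk, setIntegral_image_of_hasDerivAt hm hd hinj,
    setIntegral_congr_fun hm heq, setIntegral_puncturedDisk_one (h := fun z => h z⁻¹) hq hp
    (hh.comp (fun z hz => (hd z hz).differentiableAt.differentiableWithinAt) hmaps) hi]
  -- Inversion exchanges the half-axes carrying the two nodes; the symmetric sum does not notice.
  have e : ((nodeModulus q p 1 : ℂ) * I)⁻¹ = -((nodeModulus q p 1 : ℂ)⁻¹ * I) := by
    rw [mul_inv, inv_I]; ring
  simp only [inv_neg, e, neg_neg, ofReal_inv]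
  ring

end inversion

/-! ### The Joukowski map and the ellipse equation -/

section joukowski

variable {a b : ℝ}

lemma joukowski_eq_twoTerm (a b : ℝ) :
    joukowski a b = twoTerm ((a - b) / 2) ((a + b) / 2) := by
  ext ζ
  simp only [joukowski, twoTerm]
  push_cast
  ring

lemma meromorphicOrderAt_twoTerm {p q : ℝ} (hq : q ≠ 0) :
    meromorphicOrderAt (twoTerm p q) 0 = -1 := by
  have hm : MeromorphicAt (twoTerm p q) 0 := by unfold twoTerm; fun_prop
  refine (meromorphicOrderAt_eq_int_iff (n := -1) hm).2
    ⟨fun z => p * z ^ 2 + q, by fun_prop, by simpa using hq, ?_⟩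
  filter_upwards [self_mem_nhdsWithin] with z hz
  have hz0 : z ≠ 0 := hz
  simp only [twoTerm, sub_zero, zpow_neg_one, smul_eq_mul]
  field_simp

lemma twoTerm_inv (p q : ℝ) : (fun w => twoTerm p q w⁻¹) = twoTerm q p := by
  ext w; simp [twoTerm, add_comm]

/-- The quadratic form whose unit level set is the ellipse. -/
def ellipseForm (a b : ℝ) (z : ℂ) : ℝ := z.re ^ 2 / a ^ 2 + z.im ^ 2 / b ^ 2

/-- In real coordinates f scales x by p + q/|ζ|² and y by p - q/|ζ|². When b < a, both circles |ζ| =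
1 and |ζ| = q/p land on the ellipse, which explains the two factors. -/
lemma ellipseForm_joukowski (ha : a ≠ 0) (hb : b ≠ 0) {ζ : ℂ} (hζ : ζ ≠ 0) :
    ellipseForm a b (joukowski a b ζ) - 1 =
      (‖ζ‖ ^ 2 - 1) * (((a - b) / 2) ^ 2 * ‖ζ‖ ^ 2 - ((a + b) / 2) ^ 2) / ‖ζ‖ ^ 4 *
        ellipseForm a b ζ := by
  have hN : ζ.re ^ 2 + ζ.im ^ 2 ≠ 0 := by
    have := normSq_pos.2 hζ
    rw [normSq_apply] at this
    nlinarith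
  have h1 : ‖ζ‖ ^ 2 = ζ.re ^ 2 + ζ.im ^ 2 := by rw [← normSq_eq_norm_sq, normSq_apply]; ring
  have h2 : ‖ζ‖ ^ 4 = (ζ.re ^ 2 + ζ.im ^ 2) ^ 2 := by rw [← h1]; ring
  have hre : (joukowski a b ζ).re =
      ((a - b) / 2 + (a + b) / 2 / (ζ.re ^ 2 + ζ.im ^ 2)) * ζ.re := by
    rw [joukowski_eq_twoTerm]
    simp only [twoTerm, add_re, re_ofReal_mul, inv_re, normSq_apply]
    ring
  have him : (joukowski a b ζ).im =
      ((a - b) / 2 - (a + b) / 2 / (ζ.re ^ 2 + ζ.im ^ 2)) * ζ.im := by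
    rw [joukowski_eq_twoTerm]
    simp only [twoTerm, add_im, im_ofReal_mul, inv_im, normSq_apply]
    ring
  simp only [ellipseForm, hre, him, h1, h2]
  field_simp
  ring

end joukowski

/-! ### Counting preimages -/

section sheets

lemma finsum_mem_ite_eq (U : Set ℂ) (c : ℂ) [Decidable (c ∈ U)] [DecidableEq ℂ] :
    ∑ᶠ ζ ∈ U, (if ζ = c then 1 else 0 : ℕ) = if c ∈ U then 1 else 0 := by
  rw [finsum_eq_single _ c fun x hx => by simp [hx]]
  by_cases h : c ∈ U <;> simp [h]

lemma analyticOrderAt_sub_const [DecidableEq ℂ] (c ζ : ℂ) :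
    analyticOrderAt (fun w : ℂ => w - c) ζ = (if ζ = c then 1 else 0 : ℕ) := by
  by_cases h : ζ = c
  · subst h; simp
  · simp [h]

/-- The roots of `pζ² - zζ + q`, ordered by modulus. -/
lemma exists_ordered_roots {p q : ℝ} (hp : 0 < p) (hq : 0 < q) (z : ℂ) :
    ∃ ζ₁ ζ₂ : ℂ, ζ₁ ≠ 0 ∧ ζ₂ ≠ 0 ∧ ‖ζ₁‖ ≤ ‖ζ₂‖ ∧ ‖ζ₁‖ * ‖ζ₂‖ = q / p ∧
      ∀ w ≠ 0, twoTerm p q w - z = p * w⁻¹ * ((w - ζ₁) * (w - ζ₂)) := by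
  have hp0 : (p : ℂ) ≠ 0 := by exact_mod_cast hp.ne'
  have hq0 : (q : ℂ) ≠ 0 := by exact_mod_cast hq.ne'
  obtain ⟨s, hs⟩ := IsSquare.exists_sq (z ^ 2 - 4 * p * q) (IsAlgClosed.exists_eq_mul_self _)
  set u := (z + s) / (2 * p) with hu
  set v := (z - s) / (2 * p) with hv
  have hprod : u * v = q / p := by
    rw [hu, hv]; field_simp; linear_combination hs
  have hsum : u + v = z / p := by
    rw [hu, hv]; field_simp; ring
  have huv : u * v ≠ 0 := by rw [hprod]; exact div_ne_zero hq0 hp0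
  have hnorm : ‖u‖ * ‖v‖ = q / p := by
    rw [← norm_mul, hprod, norm_div, norm_real, norm_real, Real.norm_of_nonneg hq.le,
      Real.norm_of_nonneg hp.le]
  have hfac : ∀ w ≠ 0, twoTerm p q w - z = p * w⁻¹ * ((w - u) * (w - v)) := by
    intro w hw
    have e : (w - u) * (w - v) = w ^ 2 - z / p * w + q / p := by
      rw [← hprod, ← hsum]; ring
    rw [e, twoTerm]
    field_simp
    ring
  have hu0 := left_ne_zero_of_mul huv
  have hv0 := right_ne_zero_of_mul huv
  rcases le_total ‖u‖ ‖v‖ with h | h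
  · exact ⟨u, v, hu0, hv0, h, hnorm, hfac⟩
  · exact ⟨v, u, hv0, hu0, h, by rw [mul_comm, hnorm], fun w hw => by rw [hfac w hw]; ring⟩

-- Away from 0, f - z is a unit times (w - ζ₁)(w - ζ₂); orders add, so a double root is counted
-- twice.
open Classical in
lemma sheetNumber_eq {f : ℂ → ℂ} {U : Set ℂ} {z p ζ₁ ζ₂ : ℂ} (hp : p ≠ 0) (hU : ∀ ζ ∈ U, ζ ≠ 0)
    (hf : ∀ w ≠ 0, f w - z = p * w⁻¹ * ((w - ζ₁) * (w - ζ₂))) :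
    sheetNumber f U z = (if ζ₁ ∈ U then 1 else 0) + (if ζ₂ ∈ U then 1 else 0) := by
  have hord : ∀ ζ ∈ U, analyticOrderNatAt (fun w => f w - z) ζ =
      (if ζ = ζ₁ then 1 else 0) + (if ζ = ζ₂ then 1 else 0) := by
    intro ζ hζ
    have hζ0 := hU ζ hζ
    have hc : (fun w => f w - z) =ᶠ[𝓝 ζ]
        (fun w => p * w⁻¹) * ((fun w => w - ζ₁) * (fun w => w - ζ₂)) := by
      filter_upwards [isOpen_ne.mem_nhds hζ0] with w hw using hf w hw
    have h1 : AnalyticAt ℂ (fun w : ℂ => p * w⁻¹) ζ :=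
      analyticAt_const.mul (analyticAt_id.inv hζ0)
    have h2 : AnalyticAt ℂ (fun w : ℂ => w - ζ₁) ζ := by fun_prop
    have h3 : AnalyticAt ℂ (fun w : ℂ => w - ζ₂) ζ := by fun_prop
    have h4 : analyticOrderAt (fun w : ℂ => p * w⁻¹) ζ = 0 :=
      h1.analyticOrderAt_eq_zero.2 (mul_ne_zero hp (inv_ne_zero hζ0))
    rw [analyticOrderNatAt, analyticOrderAt_congr hc, analyticOrderAt_mul h1 (h2.mul h3),
      analyticOrderAt_mul h2 h3, h4, analyticOrderAt_sub_const, analyticOrderAt_sub_const,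
      zero_add, ← Nat.cast_add, ENat.toNat_natCast]
  have hfin : ∀ c : ℂ, (U ∩ Function.support fun ζ => (if ζ = c then 1 else 0 : ℕ)).Finite :=
    fun c => (finite_singleton c).subset fun ζ hζ => by simpa using hζ.2
  rw [sheetNumber, finsum_mem_congr rfl hord, finsum_mem_add_distrib' (hfin _) (hfin _),
    finsum_mem_ite_eq, finsum_mem_ite_eq]

variable {a b : ℝ}

/-- Sign form of `ellipseForm_joukowski`: f(ζ) is inside the ellipse exactly when |ζ| lies strictly
between 1 and q/p. -/
lemma norm_sq_criterion (hb : 0 < b) (hab : b < a) {ζ : ℂ} (hζ : ζ ≠ 0) :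
    ∃ c : ℝ, 0 < c ∧ ellipseForm a b (joukowski a b ζ) - 1 =
      c * ((‖ζ‖ - 1) * ((a - b) / 2 * ‖ζ‖ - (a + b) / 2)) := by
  have ha : 0 < a := hb.trans hab
  have hn : 0 < ‖ζ‖ := norm_pos_iff.2 hζ
  have hE : 0 < ellipseForm a b ζ := by
    by_contra! h
    have h1 : 0 ≤ ζ.re ^ 2 / a ^ 2 := by positivity
    have h2 : 0 ≤ ζ.im ^ 2 / b ^ 2 := by positivity
    unfold ellipseForm at h
    have h3 : ζ.re ^ 2 / a ^ 2 = 0 := by linarith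
    have h4 : ζ.im ^ 2 / b ^ 2 = 0 := by linarith
    apply hζ
    apply Complex.ext
    · simpa [ha.ne'] using h3
    · simpa [hb.ne'] using h4
  refine ⟨(‖ζ‖ + 1) * ((a - b) / 2 * ‖ζ‖ + (a + b) / 2) / ‖ζ‖ ^ 4 * ellipseForm a b ζ, ?_, ?_⟩
  · have : 0 < (a - b) / 2 := by linarith
    positivity
  · rw [ellipseForm_joukowski ha.ne' hb.ne' hζ]
    ring

lemma unitDisk_diff_zero : unitDisk \ {0} = puncturedDisk 1 := by
  ext ζ
  exact ⟨fun h => ⟨norm_pos_iff.2 h.2, h.1⟩, fun h => ⟨h.2, norm_pos_iff.1 h.1⟩⟩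

lemma bijOn_joukowski (hb : 0 < b) (hab : b < a) :
    BijOn (joukowski a b) (unitDisk \ {0}) (ellipseExterior a b) := by
  have hp : 0 < (a - b) / 2 := by linarith
  have hq : 0 < (a + b) / 2 := by linarith
  have hqp : 1 < (a + b) / 2 / ((a - b) / 2) := by rw [one_lt_div hp]; linarith
  rw [unitDisk_diff_zero]
  refine ⟨fun ζ hζ => ?_, fun ζ hζ w hw hfw => ?_, fun z hz => ?_⟩
  · obtain ⟨c, hc, he⟩ := norm_sq_criterion hb hab (norm_pos_iff.1 hζ.1)
    have h1 : 0 < (‖ζ‖ - 1) * ((a - b) / 2 * ‖ζ‖ - (a + b) / 2) :=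
      mul_pos_of_neg_of_neg (by linarith [hζ.2]) (by nlinarith [hζ.2])
    have h2 := mul_pos hc h1
    change 1 < ellipseForm a b (joukowski a b ζ)
    linarith
  · by_contra hne
    have hz0 : ζ ≠ 0 := norm_pos_iff.1 hζ.1
    have hw0 : w ≠ 0 := norm_pos_iff.1 hw.1
    rw [joukowski_eq_twoTerm] at hfw
    set p := (a - b) / 2
    set q := (a + b) / 2
    have hp0 : (p : ℂ) ≠ 0 := by exact_mod_cast hp.ne'
    -- Distinct preimages of one value have product q/p > 1, so they cannot both lie in the disk.
    have h1 : (ζ - w) * (p * (ζ * w) - q) = 0 := by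
      simp only [twoTerm] at hfw
      field_simp at hfw
      linear_combination hfw
    have h2 : (p : ℂ) * (ζ * w) = q :=
      sub_eq_zero.1 ((mul_eq_zero.1 h1).resolve_left (sub_ne_zero.2 hne))
    have h3 : p * (‖ζ‖ * ‖w‖) = q := by
      have := congrArg norm h2
      simpa [abs_of_pos hp, abs_of_pos hq] using this
    have h4 : ‖ζ‖ * ‖w‖ < 1 := mul_lt_one_of_nonneg_of_lt_one_left hζ.1.le hζ.2 hw.2.le
    rw [one_lt_div hp] at hqp
    nlinarith
  · obtain ⟨ζ₁, ζ₂, h1, h2, hle, hmul, hfac⟩ := exists_ordered_roots hp hq z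
    have hfz : joukowski a b ζ₁ = z := by
      have := hfac ζ₁ h1
      rw [sub_self, zero_mul, mul_zero] at this
      rw [joukowski_eq_twoTerm]
      exact sub_eq_zero.1 this
    refine ⟨ζ₁, ⟨norm_pos_iff.2 h1, ?_⟩, hfz⟩
    obtain ⟨c, hc, he⟩ := norm_sq_criterion hb hab h1
    rw [hfz] at he
    have hz1 : 1 < ellipseForm a b z := hz
    by_contra! hge
    -- If the smaller root had modulus at least 1, both moduli would lie in [1, q/p], which puts z
    -- in the closed ellipse.
    have h3 : ‖ζ₁‖ ≤ (a + b) / 2 / ((a - b) / 2) := by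
      rw [← hmul]
      exact le_mul_of_one_le_right (norm_nonneg _) (hge.trans hle)
    rw [le_div_iff₀ hp] at h3
    have h4 : (‖ζ₁‖ - 1) * ((a - b) / 2 * ‖ζ₁‖ - (a + b) / 2) ≤ 0 :=
      mul_nonpos_of_nonneg_of_nonpos (by linarith) (by linarith)
    nlinarith [mul_nonneg hc.le (neg_nonneg.2 h4)]

/-- The larger root always lies outside the unit disk because the product of the roots exceeds 1 in
modulus; the smaller one does exactly when z is inside the ellipse. -/
lemma sheetNumber_joukowski (hb : 0 < b) (hab : b < a) (z : ℂ) :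
    (z ∈ ellipseInterior a b → sheetNumber (joukowski a b) diskExterior z = 2) ∧
      (z ∉ ellipseInterior a b → sheetNumber (joukowski a b) diskExterior z = 1) := by
  classical
  have hp : 0 < (a - b) / 2 := by linarith
  have hq : 0 < (a + b) / 2 := by linarith
  have hqp : 1 < (a + b) / 2 / ((a - b) / 2) := by rw [one_lt_div hp]; linarith
  obtain ⟨ζ₁, ζ₂, h1, h2, hle, hmul, hfac⟩ := exists_ordered_roots hp hq z
  have hp0 : (((a - b) / 2 : ℝ) : ℂ) ≠ 0 := by exact_mod_cast hp.ne'
  have hn1 := norm_pos_iff.2 h1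
  have hmem2 : ζ₂ ∈ diskExterior := by
    change 1 < ‖ζ₂‖
    by_contra! h
    have := mul_le_one₀ (hle.trans h) (norm_nonneg _) h
    linarith
  have hfz : joukowski a b ζ₁ = z := by
    have := hfac ζ₁ h1
    rw [sub_self, zero_mul, mul_zero] at this
    rw [joukowski_eq_twoTerm]
    exact sub_eq_zero.1 this
  obtain ⟨c, hc, he⟩ := norm_sq_criterion hb hab h1
  rw [hfz] at he
  have hmem2' : 1 < ‖ζ₂‖ := hmem2
  have hlt : (a - b) / 2 * ‖ζ₁‖ < (a + b) / 2 := by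
    have : ‖ζ₁‖ < (a + b) / 2 / ((a - b) / 2) := by
      rw [← hmul]
      exact lt_mul_of_one_lt_right hn1 hmem2'
    rw [lt_div_iff₀ hp] at this
    linarith
  have hiff : ζ₁ ∈ diskExterior ↔ z ∈ ellipseInterior a b := by
    change 1 < ‖ζ₁‖ ↔ ellipseForm a b z < 1
    constructor
    · intro h
      have := mul_pos hc (mul_pos (sub_pos.2 h) (sub_pos.2 hlt))
      nlinarith
    · intro h
      by_contra! hle1
      have := mul_nonneg hc.le (mul_nonneg (sub_nonneg.2 hle1) (sub_nonneg.2 hlt.le))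
      nlinarith
  have hs := sheetNumber_eq (f := joukowski a b) (U := diskExterior) hp0
    (fun ζ (hζ : 1 < ‖ζ‖) => norm_pos_iff.1 (one_pos.trans hζ))
    (fun w hw => by rw [joukowski_eq_twoTerm]; exact hfac w hw)
  rw [hs, if_pos hmem2]
  exact ⟨fun h => by rw [if_pos (hiff.2 h)], fun h => by rw [if_neg (fun h' => h (hiff.1 h'))]⟩

end sheets

/-! ### Closed forms of nodes and weights -/

section nodeValues

variable {a b : ℝ}

lemma sqrt_one_add_mul (a b : ℝ) :
    √((1 + a ^ 2) * (1 + b ^ 2)) = √(1 + a ^ 2) * √(1 + b ^ 2) :=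
  Real.sqrt_mul (by positivity) _

lemma sq_sqrt_one_add (a : ℝ) : √(1 + a ^ 2) ^ 2 = 1 + a ^ 2 := Real.sq_sqrt (by positivity)

lemma focal_sq (hb : 0 < b) (hab : b < a) : focal a b ^ 2 = a ^ 2 - b ^ 2 :=
  Real.sq_sqrt (by nlinarith)

lemma focal_pos (hb : 0 < b) (hab : b < a) : 0 < focal a b := Real.sqrt_pos.2 (by nlinarith)

lemma sqrt_one_add_lt (hb : 0 < b) (hab : b < a) : √(1 + b ^ 2) < √(1 + a ^ 2) :=
  Real.sqrt_lt_sqrt (by positivity) (by nlinarith)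

/-- `b √(1 + a²) < a √(1 + b²)`. -/
lemma mul_sqrt_lt (hb : 0 < b) (hab : b < a) : b * √(1 + a ^ 2) < a * √(1 + b ^ 2) := by
  have ha : 0 < a := hb.trans hab
  refine lt_of_pow_lt_pow_left₀ 2 (by positivity) ?_
  rw [mul_pow, mul_pow, sq_sqrt_one_add, sq_sqrt_one_add]
  nlinarith

/-- The nested radical is a perfect square; b < a fixes the sign of its root. -/
lemma zetaInt_eq (hb : 0 < b) (hab : b < a) :
    zetaInt a b = ((√(1 + a ^ 2) - √(1 + b ^ 2)) / focal a b : ℝ) * I := by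
  have h : 2 + a ^ 2 + b ^ 2 - 2 * √((1 + a ^ 2) * (1 + b ^ 2)) =
      (√(1 + a ^ 2) - √(1 + b ^ 2)) ^ 2 := by
    rw [sqrt_one_add_mul]
    linear_combination -sq_sqrt_one_add a - sq_sqrt_one_add b
  rw [zetaInt, h, Real.sqrt_sq (sub_pos.2 (sqrt_one_add_lt hb hab)).le]
  push_cast
  ring

lemma zetaExt_eq (a b : ℝ) :
    zetaExt a b = ((√(1 + a ^ 2) + √(1 + b ^ 2)) / focal a b : ℝ) * I := by
  have h : 2 + a ^ 2 + b ^ 2 + 2 * √((1 + a ^ 2) * (1 + b ^ 2)) =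
      (√(1 + a ^ 2) + √(1 + b ^ 2)) ^ 2 := by
    rw [sqrt_one_add_mul]
    linear_combination -sq_sqrt_one_add a - sq_sqrt_one_add b
  rw [zetaExt, h, Real.sqrt_sq (by positivity)]
  push_cast
  ring

lemma zInt_eq (hb : 0 < b) (hab : b < a) :
    zInt a b = ((a * √(1 + b ^ 2) + b * √(1 + a ^ 2)) / focal a b : ℝ) * I := by
  have ha : 0 < a := hb.trans hab
  have h : 2 * a ^ 2 * b ^ 2 + a ^ 2 + b ^ 2 + 2 * a * b * √((1 + a ^ 2) * (1 + b ^ 2)) =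
      (a * √(1 + b ^ 2) + b * √(1 + a ^ 2)) ^ 2 := by
    rw [sqrt_one_add_mul]
    linear_combination -(b ^ 2) * sq_sqrt_one_add a - a ^ 2 * sq_sqrt_one_add b
  rw [zInt, h, Real.sqrt_sq (by positivity)]
  push_cast
  ring

lemma zExt_eq (hb : 0 < b) (hab : b < a) :
    zExt a b = ((a * √(1 + b ^ 2) - b * √(1 + a ^ 2)) / focal a b : ℝ) * I := by
  have h : 2 * a ^ 2 * b ^ 2 + a ^ 2 + b ^ 2 - 2 * a * b * √((1 + a ^ 2) * (1 + b ^ 2)) =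
      (a * √(1 + b ^ 2) - b * √(1 + a ^ 2)) ^ 2 := by
    rw [sqrt_one_add_mul]
    linear_combination -(b ^ 2) * sq_sqrt_one_add a - a ^ 2 * sq_sqrt_one_add b
  rw [zExt, h, Real.sqrt_sq (sub_pos.2 (mul_sqrt_lt hb hab)).le]
  push_cast
  ring

/-- At r = 1 the two factors of the discriminant are exactly 1 + a² and 1 + b². -/
lemma nodeDisc_one (a b : ℝ) :
    nodeDisc ((a - b) / 2) ((a + b) / 2) 1 = √(1 + a ^ 2) * √(1 + b ^ 2) := by
  rw [nodeDisc, ← sqrt_one_add_mul]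
  congr 1
  unfold nodeCoeff
  ring

lemma nodeModulus_one (hb : 0 < b) (hab : b < a) :
    nodeModulus ((a - b) / 2) ((a + b) / 2) 1 =
      (√(1 + a ^ 2) - √(1 + b ^ 2)) / focal a b := by
  have h : (nodeCoeff ((a - b) / 2) ((a + b) / 2) 1 -
      nodeDisc ((a - b) / 2) ((a + b) / 2) 1) / (2 * ((a - b) / 2 * ((a + b) / 2))) =
      ((√(1 + a ^ 2) - √(1 + b ^ 2)) / focal a b) ^ 2 := by
    have h0 : a ^ 2 - b ^ 2 ≠ 0 := by nlinarith
    have h1 : 2 * ((a - b) / 2 * ((a + b) / 2)) = (a ^ 2 - b ^ 2) / 2 := by ring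
    rw [nodeDisc_one, div_pow, focal_sq hb hab, nodeCoeff, h1]
    field_simp
    linear_combination -2 * sq_sqrt_one_add a - 2 * sq_sqrt_one_add b
  rw [nodeModulus, h, Real.sqrt_sq]
  exact div_nonneg (sub_pos.2 (sqrt_one_add_lt hb hab)).le (focal_pos hb hab).le

lemma nodeModulus_comm (p q : ℝ) : nodeModulus q p 1 = nodeModulus p q 1 := by
  have h1 : nodeCoeff q p 1 = nodeCoeff p q 1 := by unfold nodeCoeff; ring
  rw [nodeModulus, nodeModulus, nodeDisc, nodeDisc, h1, mul_comm q p]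
  ring_nf

lemma nodeModulus_one_inv (hb : 0 < b) (hab : b < a) :
    (nodeModulus ((a - b) / 2) ((a + b) / 2) 1)⁻¹ =
      (√(1 + a ^ 2) + √(1 + b ^ 2)) / focal a b := by
  have hc := (focal_pos hb hab).ne'
  have h1 := (sub_pos.2 (sqrt_one_add_lt hb hab)).ne'
  rw [nodeModulus_one hb hab, inv_div, div_eq_div_iff h1 hc]
  linear_combination focal_sq hb hab - sq_sqrt_one_add a + sq_sqrt_one_add b

lemma nodeWeight_int (a b : ℝ) :
    nodeWeight ((a - b) / 2) ((a + b) / 2) 1 = weightInt a b := by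
  rw [nodeWeight, nodeDisc_one, weightInt, sqrt_one_add_mul]
  have h1 : √(1 + a ^ 2) ≠ 0 := by positivity
  have h2 : √(1 + b ^ 2) ≠ 0 := by positivity
  field_simp
  ring

lemma nodeWeight_ext (a b : ℝ) :
    nodeWeight ((a + b) / 2) ((a - b) / 2) 1 = weightExt a b := by
  have h0 : nodeDisc ((a + b) / 2) ((a - b) / 2) 1 = √(1 + a ^ 2) * √(1 + b ^ 2) := by
    rw [← nodeDisc_one, nodeDisc, nodeDisc]
    unfold nodeCoeff
    ring_nf
  rw [nodeWeight, h0, weightExt, sqrt_one_add_mul]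
  have h1 : √(1 + a ^ 2) ≠ 0 := by positivity
  have h2 : √(1 + b ^ 2) ≠ 0 := by positivity
  field_simp
  ring

lemma joukowski_mul_I {y : ℝ} (a b : ℝ) :
    joukowski a b (y * I) = (((a - b) * y - (a + b) * y⁻¹) / 2 : ℝ) * I := by
  rw [joukowski, mul_inv, inv_I]
  push_cast
  ring

lemma joukowski_neg (a b : ℝ) (ζ : ℂ) : joukowski a b (-ζ) = -joukowski a b ζ := by
  rw [joukowski, joukowski, inv_neg]
  ring

lemma joukowski_zetaInt (hb : 0 < b) (hab : b < a) :
    joukowski a b (zetaInt a b) = -zInt a b := by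
  rw [zetaInt_eq hb hab, joukowski_mul_I, ← nodeModulus_one hb hab, nodeModulus_one_inv hb hab,
    nodeModulus_one hb hab, zInt_eq hb hab, ← neg_mul, ← ofReal_neg]
  congr 2
  ring

lemma joukowski_zetaExt (hb : 0 < b) (hab : b < a) :
    joukowski a b (zetaExt a b) = zExt a b := by
  rw [zetaExt_eq, joukowski_mul_I, ← nodeModulus_one_inv hb hab, inv_inv,
    nodeModulus_one_inv hb hab, nodeModulus_one hb hab, zExt_eq hb hab]
  congr 2
  ring

lemma im_zExt_pos (hb : 0 < b) (hab : b < a) : 0 < (zExt a b).im := by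
  rw [zExt_eq hb hab, im_ofReal_mul, I_im, mul_one]
  exact div_pos (sub_pos.2 (mul_sqrt_lt hb hab)) (focal_pos hb hab)

lemma im_zExt_lt_one (hb : 0 < b) (hab : b < a) : (zExt a b).im < 1 := by
  have hc := focal_pos hb hab
  rw [zExt_eq hb hab, im_ofReal_mul, I_im, mul_one, div_lt_one hc]
  refine lt_of_pow_lt_pow_left₀ 2 hc.le ?_
  rw [focal_sq hb hab]
  have h1 : 0 < √(1 + a ^ 2) := by positivity
  -- After expanding the square, the claim is b²(1+a²) < ab√(1+a²)√(1+b²), i.e. `mul_sqrt_lt` times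
  -- b√(1+a²).
  have h2 := mul_lt_mul_of_pos_left (mul_sqrt_lt hb hab) (mul_pos hb h1)
  nlinarith [sq_sqrt_one_add a, sq_sqrt_one_add b]

lemma one_lt_im_zInt (hb : 0 < b) (hab : b < a) : 1 < (zInt a b).im := by
  have ha : 0 < a := hb.trans hab
  have hc := focal_pos hb hab
  rw [zInt_eq hb hab, im_ofReal_mul, I_im, mul_one, one_lt_div hc]
  refine lt_of_pow_lt_pow_left₀ 2 (by positivity) ?_
  rw [focal_sq hb hab]
  have h1 : 0 < a * √(1 + b ^ 2) * (b * √(1 + a ^ 2)) := by positivity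
  nlinarith [sq_sqrt_one_add a, sq_sqrt_one_add b, mul_pos ha hb, pow_pos hb 2]

end nodeValues

/-! ### The three quadrature identities -/

section forms

variable {a b : ℝ}

lemma pullbackForm_joukowski (a b : ℝ) {ζ : ℂ} (hζ : ζ ≠ 0) :
    pullbackForm (joukowski a b) ζ =
      2 * I * twoTermDensity ((a - b) / 2) ((a + b) / 2) ζ := by
  rw [pullbackForm, joukowski_eq_twoTerm, (hasDerivAt_twoTerm _ _ hζ).deriv, twoTermDensity]
  ring

/-- The origin is a null set, so the default values of the integrand at the pole play no role. -/
lemma setIntegral_unitDisk_eq (g : ℂ → ℂ) :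
    ∫ z in unitDisk, g z = ∫ z in puncturedDisk 1, g z := by
  rw [← unitDisk_diff_zero]
  exact (setIntegral_congr_set (sdiff_null_ae_eq_self (measure_singleton 0))).symm

lemma const_mul_two_I (X : ℂ) : 1 / (2 * Real.pi * I) * (2 * I * (Real.pi * X)) = X := by
  have : (Real.pi : ℂ) ≠ 0 := by exact_mod_cast Real.pi_ne_zero
  field_simp

lemma two_I_ne_zero : (2 * I : ℂ) ≠ 0 := mul_ne_zero two_ne_zero I_ne_zero

lemma integrableOn_mul_two_I_mul_iff {s : Set ℂ} {h d : ℂ → ℂ} :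
    IntegrableOn (fun z => h z * (2 * I * d z)) s ↔ IntegrableOn (fun z => h z * d z) s := by
  have : (fun z => h z * (2 * I * d z)) = fun z => 2 * I * (h z * d z) := by ext; ring
  rw [this]
  exact integrable_const_mul_iff (isUnit_iff_ne_zero.2 two_I_ne_zero) _

lemma setIntegral_mul_two_I_mul (s : Set ℂ) (h d : ℂ → ℂ) :
    ∫ z in s, h z * (2 * I * d z) = 2 * I * ∫ z in s, h z * d z := by
  rw [← integral_const_mul]
  congr 1
  ext; ring

lemma pullback_eqOn (a b : ℝ) (h : ℂ → ℂ) {s : Set ℂ} (hs : ∀ ζ ∈ s, ζ ≠ 0) :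
    EqOn (fun ζ => h ζ * pullbackForm (joukowski a b) ζ)
      (fun ζ => h ζ * (2 * I * twoTermDensity ((a - b) / 2) ((a + b) / 2) ζ)) s := fun ζ hζ => by
  simp only [pullbackForm_joukowski a b (hs ζ hζ)]

/-- The quadrature identity on the parameter disk. -/
theorem pullbackIntegral_unitDisk (hb : 0 < b) (hab : b < a) {h : ℂ → ℂ}
    (hh : DifferentiableOn ℂ h (unitDisk \ {0}))
    (hi : IntegrableOn (fun ζ => h ζ * pullbackForm (joukowski a b) ζ) unitDisk) :
    pullbackIntegral (joukowski a b) unitDisk h =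
      weightInt a b * (h (zetaInt a b) + h (-zetaInt a b)) := by
  have hm := (isOpen_puncturedDisk 1).measurableSet
  have heq := pullback_eqOn a b h (s := puncturedDisk 1) fun ζ hζ => norm_pos_iff.1 hζ.1
  rw [unitDisk_diff_zero] at hh
  have hi' := hi.mono_set (unitDisk_diff_zero ▸ sdiff_subset : puncturedDisk 1 ⊆ unitDisk)
  rw [integrableOn_congr_fun heq hm, integrableOn_mul_two_I_mul_iff] at hi'
  rw [pullbackIntegral, setIntegral_unitDisk_eq, setIntegral_congr_fun hm heq,
    setIntegral_mul_two_I_mul, setIntegral_puncturedDisk_one (by linarith) (by linarith) hh hi',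
    const_mul_two_I, nodeWeight_int, nodeModulus_one hb hab, ← zetaInt_eq hb hab]

/-- The quadrature identity on the exterior of the parameter disk. -/
theorem pullbackIntegral_diskExterior (hb : 0 < b) (hab : b < a) {h : ℂ → ℂ}
    (hh : DifferentiableOn ℂ h diskExterior)
    (hi : IntegrableOn (fun ζ => h ζ * pullbackForm (joukowski a b) ζ) diskExterior) :
    pullbackIntegral (joukowski a b) diskExterior h =
      weightExt a b * (h (zetaExt a b) + h (-zetaExt a b)) := by
  have hm := isOpen_diskExterior.measurableSet
  have heq := pullback_eqOn a b h (s := diskExterior)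
    fun ζ (hζ : 1 < ‖ζ‖) => norm_pos_iff.1 (one_pos.trans hζ)
  rw [integrableOn_congr_fun heq hm, integrableOn_mul_two_I_mul_iff] at hi
  rw [pullbackIntegral, setIntegral_congr_fun hm heq,
    setIntegral_mul_two_I_mul, setIntegral_diskExterior (by linarith) (by linarith) hh hi,
    const_mul_two_I, nodeWeight_ext, nodeModulus_comm, nodeModulus_one_inv hb hab, ← zetaExt_eq]

/-- The quadrature identity on the exterior of the ellipse. -/
theorem sphericalIntegral_ellipseExterior (hb : 0 < b) (hab : b < a) {h : ℂ → ℂ}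
    (hh : DifferentiableOn ℂ h (ellipseExterior a b))
    (hi : IntegrableOn (fun z => h z * sphericalForm z) (ellipseExterior a b)) :
    sphericalIntegral (ellipseExterior a b) h =
      weightInt a b * (h (zInt a b) + h (-zInt a b)) := by
  have hm := (isOpen_puncturedDisk 1).measurableSet
  have hbij := bijOn_joukowski hb hab
  rw [unitDisk_diff_zero] at hbij
  have hd : ∀ ζ ∈ puncturedDisk 1, HasDerivAt (joukowski a b)
      (twoTermDeriv ((a - b) / 2) ((a + b) / 2) ζ) ζ := fun ζ hζ => by
    rw [joukowski_eq_twoTerm]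
    exact hasDerivAt_twoTerm _ _ (norm_pos_iff.1 hζ.1)
  have heq : (fun ζ => (‖twoTermDeriv ((a - b) / 2) ((a + b) / 2) ζ‖ : ℂ) ^ 2 *
      (h (joukowski a b ζ) * sphericalForm (joukowski a b ζ))) =
      fun ζ => h (joukowski a b ζ) * (2 * I * twoTermDensity ((a - b) / 2) ((a + b) / 2) ζ) := by
    ext ζ
    rw [sphericalForm, twoTermDensity, ← joukowski_eq_twoTerm]
    ring
  rw [← hbij.image_eq, integrableOn_image_iff_of_hasDerivAt hm hd hbij.injOn, heq,
    integrableOn_mul_two_I_mul_iff] at hi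
  have hcomp : DifferentiableOn ℂ (fun ζ => h (joukowski a b ζ)) (puncturedDisk 1) :=
    hh.comp (fun ζ hζ => (hd ζ hζ).differentiableAt.differentiableWithinAt) hbij.mapsTo
  rw [sphericalIntegral, ← hbij.image_eq, setIntegral_image_of_hasDerivAt hm hd hbij.injOn, heq,
    setIntegral_mul_two_I_mul (puncturedDisk 1) (fun ζ => h (joukowski a b ζ)),
    setIntegral_puncturedDisk_one (h := fun ζ => h (joukowski a b ζ)) (by linarith) (by linarith)
      hcomp hi,
    const_mul_two_I, nodeWeight_int, nodeModulus_one hb hab, ← zetaInt_eq hb hab, joukowski_neg,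
    joukowski_zetaInt hb hab, neg_neg, add_comm (h (-zInt a b))]

lemma zetaInt_mem (hb : 0 < b) (hab : b < a) : zetaInt a b ∈ unitDisk \ {0} := by
  have hp : 0 < (a - b) / 2 := by linarith
  have hq : 0 < (a + b) / 2 := by linarith
  have h0 := nodeModulus_pos hp hq one_pos
  have h1 := nodeModulus_lt hp hq one_pos
  rw [unitDisk_diff_zero, zetaInt_eq hb hab, ← nodeModulus_one hb hab, puncturedDisk,
    mem_ofPred_eq, norm_mul, norm_I, mul_one, norm_real, Real.norm_of_nonneg h0.le]
  exact ⟨h0, h1⟩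

lemma zetaExt_mem (hb : 0 < b) (hab : b < a) : zetaExt a b ∈ diskExterior := by
  have hp : 0 < (a - b) / 2 := by linarith
  have hq : 0 < (a + b) / 2 := by linarith
  have h0 := nodeModulus_pos hp hq one_pos
  have h1 := nodeModulus_lt hp hq one_pos
  rw [zetaExt_eq, ← nodeModulus_one_inv hb hab, diskExterior, mem_ofPred_eq, norm_mul, norm_I,
    mul_one, norm_real, Real.norm_of_nonneg (inv_pos.2 h0).le]
  exact (one_lt_inv₀ h0).2 h1

lemma neg_mem_unitDisk_diff {ζ : ℂ} (h : ζ ∈ unitDisk \ {0}) : -ζ ∈ unitDisk \ {0} := by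
  rw [unitDisk_diff_zero] at *
  simpa only [puncturedDisk, mem_ofPred_eq, norm_neg] using h

end forms

end EllipseQuadrature

end

/-! ### Assembly of the theorem -/

theorem mainTheorem4 (a b : ℝ) (hb : 0 < b) (hab : b < a) :
    -- the Joukowski map takes the disk univalently onto the exterior of the ellipse, `0` to `∞`
    (BijOn (EllipseQuadrature.joukowski a b) (EllipseQuadrature.unitDisk \ {0})
        (EllipseQuadrature.ellipseExterior a b) ∧
      meromorphicOrderAt (EllipseQuadrature.joukowski a b) 0 = -1) ∧
    -- it takes the exterior of the disk onto the complementary domain, with two sheets over the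
    -- interior of the ellipse and one sheet over the rest of the sphere, `∞` included
    ((∀ z ∈ EllipseQuadrature.ellipseInterior a b,
        EllipseQuadrature.sheetNumber (EllipseQuadrature.joukowski a b)
          EllipseQuadrature.diskExterior z = 2) ∧
      (∀ z ∉ EllipseQuadrature.ellipseInterior a b,
        EllipseQuadrature.sheetNumber (EllipseQuadrature.joukowski a b)
          EllipseQuadrature.diskExterior z = 1) ∧
      meromorphicOrderAt (fun w => EllipseQuadrature.joukowski a b w⁻¹) 0 = -1) ∧
    -- location of the nodes
    (EllipseQuadrature.zetaInt a b ∈ EllipseQuadrature.unitDisk \ {0} ∧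
      EllipseQuadrature.zetaExt a b ∈ EllipseQuadrature.diskExterior ∧
      EllipseQuadrature.joukowski a b (EllipseQuadrature.zetaInt a b)
        = -EllipseQuadrature.zInt a b ∧
      EllipseQuadrature.joukowski a b (-EllipseQuadrature.zetaInt a b)
        = EllipseQuadrature.zInt a b ∧
      EllipseQuadrature.joukowski a b (EllipseQuadrature.zetaExt a b)
        = EllipseQuadrature.zExt a b ∧
      EllipseQuadrature.joukowski a b (-EllipseQuadrature.zetaExt a b)
        = -EllipseQuadrature.zExt a b ∧
      (EllipseQuadrature.zInt a b).re = 0 ∧ (EllipseQuadrature.zExt a b).re = 0 ∧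
      0 < (EllipseQuadrature.zExt a b).im ∧ (EllipseQuadrature.zExt a b).im < 1 ∧
      1 < (EllipseQuadrature.zInt a b).im ∧
      EllipseQuadrature.zInt a b ∈ EllipseQuadrature.ellipseExterior a b ∧
      -EllipseQuadrature.zInt a b ∈ EllipseQuadrature.ellipseExterior a b) ∧
    -- the quadrature identity in the physical plane
    (∀ h : ℂ → ℂ, DifferentiableOn ℂ h (EllipseQuadrature.ellipseExterior a b) →
      IntegrableOn (fun z => h z * EllipseQuadrature.sphericalForm z)
        (EllipseQuadrature.ellipseExterior a b) →
      EllipseQuadrature.sphericalIntegral (EllipseQuadrature.ellipseExterior a b) h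
        = EllipseQuadrature.weightInt a b *
          (h (EllipseQuadrature.zInt a b) + h (-EllipseQuadrature.zInt a b))) ∧
    -- the same identity in the parameter plane
    (∀ h : ℂ → ℂ, DifferentiableOn ℂ h (EllipseQuadrature.unitDisk \ {0}) →
      IntegrableOn
        (fun ζ => h ζ * EllipseQuadrature.pullbackForm (EllipseQuadrature.joukowski a b) ζ)
        EllipseQuadrature.unitDisk →
      EllipseQuadrature.pullbackIntegral (EllipseQuadrature.joukowski a b)
          EllipseQuadrature.unitDisk h
        = EllipseQuadrature.weightInt a b *
          (h (EllipseQuadrature.zetaInt a b) + h (-EllipseQuadrature.zetaInt a b))) ∧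
    -- the identity for the complementary two-sheeted domain
    (∀ h : ℂ → ℂ, DifferentiableOn ℂ h EllipseQuadrature.diskExterior →
      IntegrableOn
        (fun ζ => h ζ * EllipseQuadrature.pullbackForm (EllipseQuadrature.joukowski a b) ζ)
        EllipseQuadrature.diskExterior →
      EllipseQuadrature.pullbackIntegral (EllipseQuadrature.joukowski a b)
          EllipseQuadrature.diskExterior h
        = EllipseQuadrature.weightExt a b *
          (h (EllipseQuadrature.zetaExt a b) + h (-EllipseQuadrature.zetaExt a b))) ∧
    EllipseQuadrature.weightInt a b + EllipseQuadrature.weightExt a b = 1 := by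
  have hp : (a - b) / 2 ≠ 0 := by linarith
  have hq : (a + b) / 2 ≠ 0 := by linarith
  have hbij := EllipseQuadrature.bijOn_joukowski hb hab
  have hmem := EllipseQuadrature.zetaInt_mem hb hab
  have hint := EllipseQuadrature.joukowski_zetaInt hb hab
  have hext := EllipseQuadrature.joukowski_zetaExt hb hab
  have hint' : EllipseQuadrature.joukowski a b (-EllipseQuadrature.zetaInt a b) =
      EllipseQuadrature.zInt a b := by
    rw [EllipseQuadrature.joukowski_neg, hint, neg_neg]
  refine ⟨⟨hbij, ?_⟩, ⟨fun z hz => (EllipseQuadrature.sheetNumber_joukowski hb hab z).1 hz,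
    fun z hz => (EllipseQuadrature.sheetNumber_joukowski hb hab z).2 hz, ?_⟩,
    ⟨hmem, EllipseQuadrature.zetaExt_mem hb hab, hint, hint', hext, ?_, ?_, ?_,
      EllipseQuadrature.im_zExt_pos hb hab, EllipseQuadrature.im_zExt_lt_one hb hab,
      EllipseQuadrature.one_lt_im_zInt hb hab, ?_, ?_⟩,
    fun h hh hi => EllipseQuadrature.sphericalIntegral_ellipseExterior hb hab hh hi,
    fun h hh hi => EllipseQuadrature.pullbackIntegral_unitDisk hb hab hh hi,
    fun h hh hi => EllipseQuadrature.pullbackIntegral_diskExterior hb hab hh hi, ?_⟩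
  · rw [EllipseQuadrature.joukowski_eq_twoTerm]
    exact EllipseQuadrature.meromorphicOrderAt_twoTerm hq
  · rw [EllipseQuadrature.joukowski_eq_twoTerm, EllipseQuadrature.twoTerm_inv]
    exact EllipseQuadrature.meromorphicOrderAt_twoTerm hp
  · rw [EllipseQuadrature.joukowski_neg, hext]
  · simp [EllipseQuadrature.zInt_eq hb hab]
  · simp [EllipseQuadrature.zExt_eq hb hab]
  · exact hint' ▸ hbij.mapsTo (EllipseQuadrature.neg_mem_unitDisk_diff hmem)
  · exact hint ▸ hbij.mapsTo hmem
  · rw [EllipseQuadrature.weightInt, EllipseQuadrature.weightExt]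
    ring
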